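/- **Theorem 3.2.** Let $n\ge 1$ be an integer and let $\nu\in\mathbb C$ with $|\mathrm{Re}\,\nu|<1/2$. Let $J_\nu(z)=\sum_{r\ge 0}\frac{(-1)^r}{r!\,\Gamma(\nu+r+1)}(z/2)^{\nu+2r}$. The function $|\xi|^{\nu}J_\nu(|\xi|)$ on $\mathbb R^n$ defines a tempered distribution. Let $T_\nu=\mathcal F^{-1}\big[|\xi|^{\nu}J_\nu(|\xi|)\big]$ be its inverse Fourier transform (with $\mathcal F^{-1}g(x)=(2\pi)^{-n}\int_{\mathbb R^n} e^{i\langle x,\xi\rangle}g(\xi)\,d\xi$, extended by duality). Then $T_\nu$ is the limit, in the space of tempered distributions as $\varepsilon\to0^+$, of the functions $$x\mapsto\frac1{(2\pi)^n}\int_{\mathbb R^n}e^{i\langle x,\xi\rangle-\varepsilon|\xi|}\,|\xi|^{\nu}J_\nu(|\xi|)\,d\xi ,$$ and it is the distribution defined by the function $$f_\nu(x)=\begin{cases}\displaystyle \sin\!\big(\tfrac{n\pi}2\big)\,\frac{2^\nu\Gamma(\frac n2+\nu)}{\pi^{\frac n2+1}}\,(1-|x|^2)^{-\frac n2-\nu},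 & |x|<1,\\[2mm] \displaystyle -\sin(\nu\pi)\,\frac{2^\nu\Gamma(\frac n2+\nu)}{\pi^{\frac n2+1}}\,(|x|^2-1)^{-\frac n2-\nu}, & |x|>1,\end{cases}$$ in the following sense. 1. $\langle T_\nu,\varphi\rangle=\int f_\nu\varphi\,dx$ (absolutely convergent) for every Schwartz function $\varphi$ whose support is disjoint from the unit sphere $|x|=1$. 2. If $\frac n2+\mathrm{Re}\,\nu<1$, so that $f_\nu$ is locally integrable, this equality holds for every Schwartz function $\varphi$. 3. In all cases $T_\nu$ is the regularization of $f_\nu$ by analytic continuation in the parameter: for every Schwartz function $\varphi$, the function $s\mapsto\int f_s\varphi\,dx$ (defined by absolutely convergent integrals for $-\frac n2<\mathrm{Re}\,s<1-\frac n2$) extends to a holomorphic function on $\mathrm{Re}\,s>-\frac n2$, whose value at $s=\nu$ is $\langle T_\nu,\varphi\rangle$. -/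

import Mathlib

open Filter Topology MeasureTheory
open scoped SchwartzMap

noncomputable section

/-- The Bessel function of the first kind `J_ν(z) = ∑ (-1)^r (z/2)^(ν+2r) / (r! Γ(ν+r+1))`,
with the principal branch of the power. (At a pole of `Γ`, Mathlib's value `Γ = 0` gives the
usual convention `1/Γ = 0`.) -/
def besselJ (ν z : ℂ) : ℂ :=
  ∑' r : ℕ, (-1 : ℂ) ^ r / ((r.factorial : ℂ) * Complex.Gamma (ν + r + 1)) *
    (z / 2) ^ (ν + 2 * (r : ℂ))

/-- The function `ξ ↦ |ξ|^ν J_ν(|ξ|)` on `ℝⁿ`. -/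
def besselSymbol (n : ℕ) (ν : ℂ) (ξ : EuclideanSpace ℝ (Fin n)) : ℂ :=
  (‖ξ‖ : ℂ) ^ ν * besselJ ν (‖ξ‖ : ℂ)

/-- The inverse Fourier integral `(2π)^(-n) ∫ e^{i⟨x,ξ⟩} g(ξ) dξ`. -/
def invFourierIntegral {n : ℕ} (g : EuclideanSpace ℝ (Fin n) → ℂ)
    (x : EuclideanSpace ℝ (Fin n)) : ℂ :=
  ((2 * Real.pi : ℝ) : ℂ)⁻¹ ^ n *
    ∫ ξ : EuclideanSpace ℝ (Fin n), Complex.exp (Complex.I * ((inner ℝ x ξ : ℝ) : ℂ)) * g ξ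

/-- The symbol `g` multiplied by the converging factor `e^{-ε|ξ|}`. -/
def damped {n : ℕ} (g : EuclideanSpace ℝ (Fin n) → ℂ) (ε : ℝ)
    (ξ : EuclideanSpace ℝ (Fin n)) : ℂ :=
  (Real.exp (-ε * ‖ξ‖) : ℂ) * g ξ

/-- `T` is the inverse Fourier transform of the tempered distribution defined by the function `g`:
`⟨T, φ⟩ = ⟨g, ℱ⁻¹ φ⟩` for all Schwartz `φ`, all the integrals converging absolutely. -/
def IsInvFourierTransform {n : ℕ} (g : EuclideanSpace ℝ (Fin n) → ℂ)
    (T : 𝓢'(EuclideanSpace ℝ (Fin n), ℂ)) : Prop :=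
  ∀ φ : 𝓢(EuclideanSpace ℝ (Fin n), ℂ),
    Integrable (fun ξ => g ξ * φ ξ) ∧
    Integrable (fun ξ => g ξ * invFourierIntegral (fun x => φ x) ξ) ∧
    T φ = ∫ ξ, g ξ * invFourierIntegral (fun x => φ x) ξ

/-- `T` is the limit in the space of tempered distributions, as `ε → 0+`, of the functions
`x ↦ (2π)^(-n) ∫ e^{i⟨x,ξ⟩ - ε|ξ|} g(ξ) dξ`, these integrals converging absolutely. -/
def IsDampedInvFourierLimit {n : ℕ} (g : EuclideanSpace ℝ (Fin n) → ℂ)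
    (T : 𝓢'(EuclideanSpace ℝ (Fin n), ℂ)) : Prop :=
  (∀ ε : ℝ, 0 < ε → Integrable (damped g ε)) ∧
  (∀ ε : ℝ, 0 < ε → ∀ φ : 𝓢(EuclideanSpace ℝ (Fin n), ℂ),
    Integrable (fun x => invFourierIntegral (damped g ε) x * φ x)) ∧
  ∀ φ : 𝓢(EuclideanSpace ℝ (Fin n), ℂ),
    Tendsto (fun ε : ℝ => ∫ x, invFourierIntegral (damped g ε) x * φ x) (𝓝[>] 0) (𝓝 (T φ))

/-- The explicit function
`sin(nπ/2) C (1-|x|²)^(-n/2-ν)` for `|x| < 1` and `-sin(νπ) C (|x|²-1)^(-n/2-ν)` for `|x| > 1`,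
where `C = 2^ν Γ(n/2+ν) / π^(n/2+1)`; the value on the (null) unit sphere is irrelevant. -/
def besselTransform (n : ℕ) (ν : ℂ) (x : EuclideanSpace ℝ (Fin n)) : ℂ :=
  if ‖x‖ < 1 then
    Complex.sin ((n : ℂ) * Real.pi / 2) *
      ((2 : ℂ) ^ ν * Complex.Gamma ((n : ℂ) / 2 + ν) / (Real.pi : ℂ) ^ ((n : ℂ) / 2 + 1)) *
      ((1 - ‖x‖ ^ 2 : ℝ) : ℂ) ^ (-((n : ℂ) / 2) - ν)
  else if 1 < ‖x‖ then
    -Complex.sin (ν * Real.pi) *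
      ((2 : ℂ) ^ ν * Complex.Gamma ((n : ℂ) / 2 + ν) / (Real.pi : ℂ) ^ ((n : ℂ) / 2 + 1)) *
      ((‖x‖ ^ 2 - 1 : ℝ) : ℂ) ^ (-((n : ℂ) / 2) - ν)
  else 0

/-- A function `f` represents `T` against the test function `φ`. -/
def RepresentsOn {n : ℕ} (f : EuclideanSpace ℝ (Fin n) → ℂ)
    (T : 𝓢'(EuclideanSpace ℝ (Fin n), ℂ)) (φ : 𝓢(EuclideanSpace ℝ (Fin n), ℂ)) : Prop :=
  Integrable (fun x => f x * φ x) ∧ T φ = ∫ x, f x * φ x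

/-- The meaning across the unit sphere of "the distribution defined by `besselTransform n ν`" when
this function is not locally integrable there: regularization by analytic continuation in the
parameter. For `-n/2 < Re s < 1 - n/2` the function `besselTransform n s` is locally integrable and
is paired with `φ` by integration; the pairing extends to a holomorphic function `G` of `s` in the
half-plane `Re s > -n/2` (unique by the identity theorem), and the value at `φ` of the distribution
with parameter `ν` is `G ν`. -/
def IsRegularizedPairing (n : ℕ) (ν : ℂ) (φ : 𝓢(EuclideanSpace ℝ (Fin n), ℂ)) (c : ℂ) : Prop :=
  ∃ G : ℂ → ℂ,
    DifferentiableOn ℂ G {s : ℂ | -((n : ℝ) / 2) < s.re} ∧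
    (∀ s : ℂ, -((n : ℝ) / 2) < s.re → s.re < 1 - (n : ℝ) / 2 →
      Integrable (fun x => besselTransform n s x * φ x) ∧
      G s = ∫ x, besselTransform n s x * φ x) ∧
    G ν = c

end

noncomputable section

/-! The symbol is a superposition of Gaussians in `ξ`, and Gaussians have explicit inverse Fourier
transforms. With `x = |ξ|²/4`, the symbol is `2^s x^s besselSeries s x`. Expanding `e^{-1/v}` and
inverting Laplace transforms term by term gives, for `Re s > 0`, `x^s besselSeries s x = (2πi)⁻¹ ∫
v^{-(s+1)} e^{xv - 1/v} dv` over `Re v = δ` (`cpow_mul_besselSeries_eq_integral`). After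
multiplication by `e^{-δ|ξ|²/2}` the exponential `e^{xv}` becomes `e^{-(δ-iy)|ξ|²/4}`. Its pairing
with `ℱ⁻¹φ` is a Gaussian integral of `φ` of size `O(|v|^{-n/2})` (`exists_norm_gaussPairing_le`).
This extra decay carries the formula by analytic continuation from `Re s > 0` to `Re s > -n/2`
(`integral_besselSymbol_mul_gaussian`).

For `-n/2 < Re s < 0` the line can be moved to the imaginary axis (`integral_besselSymbol_mul_eq`).
There `e^{-1/v}` and the Gaussian in `x` merge into `e^{±i(1-|x|²)/y}`. If moreover `Re s < 1 -
n/2`, integrating over `y` with an Abel factor is a Gamma integral, giving `Γ(n/2+s)` times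
`(∓i(1-|x|²))^{-n/2-s}` (`integral_cpow_mul_oscillatory`). The phases of the two half-lines add up
to the two sines (`besselTransform_eq`).

The identity theorem does the rest. Polynomial bounds on the series make the Fourier-side pairing
holomorphic on all of `Re s > -n/2`; the pairing with the explicit function is holomorphic wherever
it converges absolutely. So they agree on the whole strip of local integrability, and on the whole
half-plane when `φ` is supported off the sphere. In general the Fourier-side pairing is itself the
required continuation. -/

/-! ### Holomorphic dependence of integrals on a parameter -/

theorem tendsto_add_ofReal_div_nhdsNE (s : ℂ) {c : ℝ} (hc : c ≠ 0) :
    Tendsto (fun k : ℕ => s + ((c / ((k : ℝ) + 1) : ℝ) : ℂ)) atTop (𝓝[≠] s) := by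
  refine tendsto_nhdsWithin_iff.2 ⟨?_, Eventually.of_forall fun k => ?_⟩
  · have h1 : Tendsto (fun k : ℕ => c / ((k : ℝ) + 1)) atTop (𝓝 0) :=
      tendsto_const_div_atTop_nhds_zero_nat c |>.comp (tendsto_add_atTop_nat 1) |>.congr
        fun k => by simp
    have h2 := (Complex.continuous_ofReal.tendsto 0).comp h1
    simpa using h2.const_add s
  · have h : c / ((k : ℝ) + 1) ≠ 0 := div_ne_zero hc (by positivity)
    have h2 : ((c / ((k : ℝ) + 1) : ℝ) : ℂ) ≠ 0 := Complex.ofReal_ne_zero.2 h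
    intro h3
    exact h2 (add_eq_left.1 h3)

/-- Cauchy's estimate turns a local integrable bound on `F` into one on its derivative, so no
derivative ever has to be estimated by hand. -/
theorem differentiableOn_integral_of_locally_dominated {α : Type*} [MeasurableSpace α]
    {μ : Measure α} {F : ℂ → α → ℂ} {U : Set ℂ} (hU : IsOpen U)
    (hmeas : ∀ s ∈ U, AEStronglyMeasurable (F s) μ)
    (hdiff : ∀ᵐ a ∂μ, DifferentiableOn ℂ (fun s => F s a) U)
    (hbound : ∀ s ∈ U, ∃ V ∈ 𝓝 s, ∃ b : α → ℝ, Integrable b μ ∧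
      ∀ᵐ a ∂μ, ∀ z ∈ V, ‖F z a‖ ≤ b a) :
    DifferentiableOn ℂ (fun s => ∫ a, F s a ∂μ) U := by
  intro s hs
  obtain ⟨V, hV, b, hb, hVb⟩ := hbound s hs
  obtain ⟨R, hR, hRV⟩ := Metric.mem_nhds_iff.1 (inter_mem hV (hU.mem_nhds hs))
  have hR2 : 0 < R / 2 := by positivity
  have hsub : ∀ z ∈ Metric.ball s (R / 2), Metric.closedBall z (R / 4) ⊆ Metric.ball s R := by
    intro z hz w hw
    rw [Metric.mem_ball] at hz ⊢
    rw [Metric.mem_closedBall] at hw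
    linarith [dist_triangle w z s]
  have hmem : ∀ z ∈ Metric.ball s (R / 2), z ∈ U := fun z hz =>
    (hRV (hsub z hz (Metric.mem_closedBall_self (by positivity)))).2
  have hdeq : ∀ᵐ a ∂μ, ∀ z ∈ Metric.ball s (R / 2),
      HasDerivAt (fun s => F s a) (deriv (fun s => F s a) z) z := by
    filter_upwards [hdiff] with a ha z hz
    exact (ha.differentiableAt (hU.mem_nhds (hmem z hz))).hasDerivAt
  refine ((hasDerivAt_integral_of_dominated_loc_of_deriv_le
    (F' := fun z a => deriv (fun s => F s a) z) (bound := fun a => b a / (R / 4))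
    (Metric.ball_mem_nhds s hR2) ?_ ?_ ?_ ?_ (hb.div_const _)
    hdeq).2.differentiableAt).differentiableWithinAt
  · filter_upwards [Metric.ball_mem_nhds s hR2] with z hz using hmeas z (hmem z hz)
  · refine hb.mono' (hmeas s hs) ?_
    filter_upwards [hVb] with a ha using ha s (mem_of_mem_nhds hV)
  -- The derivative is measurable in `a` as an a.e. limit of difference quotients along a sequence.
  · have hseq := tendsto_add_ofReal_div_nhdsNE s (c := R / 4) (by positivity)
    refine aestronglyMeasurable_of_tendsto_ae (u := atTop)
      (f := fun (k : ℕ) a => slope (fun s => F s a) s (s + (((R / 4) / (k + 1) : ℝ) : ℂ)))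
      (fun k => ?_) ?_
    · simp only [slope_def_field]
      have hk : s + (((R / 4) / ((k : ℝ) + 1) : ℝ) : ℂ) ∈ Metric.ball s (R / 2) := by
        rw [Metric.mem_ball, dist_eq_norm, add_sub_cancel_left, Complex.norm_real, Real.norm_eq_abs,
          abs_of_pos (by positivity)]
        have : R / 4 / ((k : ℝ) + 1) ≤ R / 4 := div_le_self (by positivity) (by simp)
        linarith
      exact (((hmeas _ (hmem _ hk)).sub (hmeas s hs)).mul_const _).congr
        (Eventually.of_forall fun a => (div_eq_mul_inv _ _).symm)
    · filter_upwards [hdeq] with a ha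
      exact (hasDerivAt_iff_tendsto_slope.1 (ha s (Metric.mem_ball_self hR2))).comp hseq
  · filter_upwards [hVb, hdiff] with a ha hd z hz
    refine Complex.norm_deriv_le_of_forall_mem_sphere_norm_le (by positivity) ?_ fun w hw => ?_
    · refine DifferentiableOn.diffContOnCl ?_
      rw [closure_ball _ (by positivity)]
      exact hd.mono fun w hw => (hRV (hsub z hz hw)).2
    · exact ha w (hRV (hsub z hz (Metric.sphere_subset_closedBall hw))).1

theorem Complex.norm_cpow_le_rpow_mul_exp (z s : ℂ) :
    ‖z ^ s‖ ≤ ‖z‖ ^ s.re * Real.exp (Real.pi * |s.im|) := by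
  refine (Complex.norm_cpow_le z s).trans ?_
  rw [div_eq_mul_inv, ← Real.exp_neg]
  gcongr
  calc -(z.arg * s.im) ≤ |z.arg * s.im| := neg_le_abs _
    _ ≤ Real.pi * |s.im| := by
      rw [abs_mul]; gcongr; exact Complex.abs_arg_le_pi z

/-! ### The Gamma integral and bounds for `1/Γ` -/

theorem integrableOn_rpow_mul_exp_neg_mul {a r : ℝ} (ha : 0 < a) (hr : 0 < r) :
    IntegrableOn (fun t : ℝ => t ^ (a - 1) * Real.exp (-r * t)) (Set.Ioi 0) := by
  have := integrableOn_rpow_mul_exp_neg_mul_rpow (s := a - 1) (p := 1) (b := r) (by linarith)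
    one_pos hr
  simpa using this

theorem aestronglyMeasurable_cpow_mul_cexp (a r : ℂ) :
    AEStronglyMeasurable (fun t : ℝ => (t : ℂ) ^ (a - 1) * Complex.exp (-r * t))
      (volume.restrict (Set.Ioi 0)) :=
  (by fun_prop : Measurable fun t : ℝ => (t : ℂ) ^ (a - 1) * Complex.exp (-r * t)).aestronglyMeasurable

theorem norm_cpow_mul_cexp (a r : ℂ) {t : ℝ} (ht : 0 < t) :
    ‖(t : ℂ) ^ (a - 1) * Complex.exp (-r * t)‖ = t ^ (a.re - 1) * Real.exp (-r.re * t) := by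
  rw [norm_mul, Complex.norm_cpow_eq_rpow_re_of_pos ht, Complex.norm_exp]
  simp

theorem integrableOn_cpow_mul_cexp {a r : ℂ} (ha : 0 < a.re) (hr : 0 < r.re) :
    IntegrableOn (fun t : ℝ => (t : ℂ) ^ (a - 1) * Complex.exp (-r * t)) (Set.Ioi 0) := by
  refine (integrableOn_rpow_mul_exp_neg_mul ha hr).mono' (aestronglyMeasurable_cpow_mul_cexp a r) ?_
  refine (ae_restrict_iff' measurableSet_Ioi).2 (Eventually.of_forall fun t ht => ?_)
  exact (norm_cpow_mul_cexp a r ht).le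

theorem isOpen_re_pos : IsOpen {r : ℂ | 0 < r.re} :=
  isOpen_lt continuous_const Complex.continuous_re

theorem eqOn_of_differentiableOn_of_subset {f g : ℂ → ℂ} {U V : Set ℂ} (hU : IsOpen U)
    (hUc : IsPreconnected U) (hf : DifferentiableOn ℂ f U) (hg : DifferentiableOn ℂ g U)
    (hV : IsOpen V) (hVU : V ⊆ U) (hne : V.Nonempty) (h : Set.EqOn f g V) : Set.EqOn f g U := by
  obtain ⟨z, hz⟩ := hne
  exact (hf.analyticOnNhd hU).eqOn_of_preconnected_of_eventuallyEq (hg.analyticOnNhd hU) hUc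
    (hVU hz) (h.eventuallyEq_of_mem (hV.mem_nhds hz))

/-- The Gamma integral `∫ t^(a-1) e^{-rt} dt = r^(-a) Γ(a)` for complex `r` in the right
half-plane. -/
theorem integral_cpow_mul_cexp {a r : ℂ} (ha : 0 < a.re) (hr : 0 < r.re) :
    ∫ t : ℝ in Set.Ioi 0, (t : ℂ) ^ (a - 1) * Complex.exp (-r * t) =
      r ^ (-a) * Complex.Gamma a := by
  have hL : DifferentiableOn ℂ
      (fun r : ℂ => ∫ t : ℝ in Set.Ioi 0, (t : ℂ) ^ (a - 1) * Complex.exp (-r * t))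
      {r : ℂ | 0 < r.re} := by
    refine differentiableOn_integral_of_locally_dominated isOpen_re_pos
      (fun r _ => aestronglyMeasurable_cpow_mul_cexp a r)
      (Eventually.of_forall fun t => by fun_prop) fun r hr => ?_
    have hr' : (0 : ℝ) < r.re / 2 := half_pos hr
    refine ⟨{z : ℂ | r.re / 2 < z.re}, (isOpen_lt continuous_const Complex.continuous_re).mem_nhds
      (half_lt_self hr : r.re / 2 < r.re), _, integrableOn_rpow_mul_exp_neg_mul ha hr', ?_⟩
    refine (ae_restrict_iff' measurableSet_Ioi).2 (Eventually.of_forall fun t ht z hz => ?_)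
    rw [norm_cpow_mul_cexp a z ht]
    have ht' : (0 : ℝ) < t := ht
    gcongr
    exact le_of_lt hz
  have hR : DifferentiableOn ℂ (fun r : ℂ => r ^ (-a) * Complex.Gamma a) {r : ℂ | 0 < r.re} := by
    intro r hr
    exact ((differentiableAt_id.cpow_const (Or.inl hr)).mul_const _).differentiableWithinAt
  -- Both sides are holomorphic in `r`, and the formula is known for real `r`; the real points `1 +
  -- 1/(k+1)` accumulate at `1`.
  refine (hL.analyticOnNhd isOpen_re_pos).eqOn_of_preconnected_of_frequently_eq
    (hR.analyticOnNhd isOpen_re_pos) (convex_halfSpace_re_gt 0).isPreconnected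
    (z₀ := 1) (by simp) ?_ hr
  have hseq := tendsto_add_ofReal_div_nhdsNE 1 one_ne_zero
  refine hseq.frequently (Frequently.of_forall fun k => ?_)
  have hk : (0 : ℝ) < 1 + 1 / ((k : ℝ) + 1) := by positivity
  have h := Complex.integral_cpow_mul_exp_neg_mul_Ioi ha hk
  rw [one_div ((1 + 1 / ((k : ℝ) + 1) : ℝ) : ℂ), Complex.inv_cpow _ _ (by
    rw [Complex.arg_ofReal_of_nonneg hk.le]; exact Real.pi_pos.ne), ← Complex.cpow_neg] at h
  simpa only [neg_mul, Complex.ofReal_add, Complex.ofReal_one] using h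

/-- Compactness covers `Re z ≤ 2`; further right, `1/Γ(z) = 1/((z-1)Γ(z-1))` with `|z-1| ≥ 1`
reduces to the strip on the left. This bounds all coefficients `1/Γ(s+r+1)` at once, locally
uniformly in `s`. -/
theorem exists_norm_inv_Gamma_le {A : ℝ} (hA : 0 ≤ A) (B : ℝ) :
    ∃ M : ℝ, 0 ≤ M ∧ ∀ z : ℂ, -A ≤ z.re → |z.im| ≤ B → ‖(Complex.Gamma z)⁻¹‖ ≤ M := by
  have hK : IsCompact (Set.Icc (-A) 2 ×ℂ Set.Icc (-B) B) := isCompact_Icc.reProdIm isCompact_Icc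
  obtain ⟨M, hM⟩ := hK.exists_bound_of_continuousOn
    (f := fun z => (Complex.Gamma z)⁻¹) Complex.differentiable_one_div_Gamma.continuous.continuousOn
  have key : ∀ m : ℕ, ∀ z : ℂ, -A ≤ z.re → z.re ≤ 2 + m → |z.im| ≤ B →
      ‖(Complex.Gamma z)⁻¹‖ ≤ max M 0 := by
    intro m
    induction m with
    | zero =>
      intro z h1 h2 h3
      exact (hM z ⟨⟨h1, by simpa using h2⟩, abs_le.1 h3⟩).trans (le_max_left _ _)
    | succ m ih =>
      intro z h1 h2 h3
      rcases le_or_gt z.re 2 with h | h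
      · exact ih z h1 (by linarith [(Nat.cast_nonneg m : (0 : ℝ) ≤ m)]) h3
      · have h5 := ih (z - 1) (by simp; linarith) (by push_cast at h2; simp; linarith)
          (by simpa using h3)
        have h6 : (1 : ℝ) ≤ ‖z - 1‖ := by
          refine le_trans ?_ (Complex.re_le_norm _)
          simp; linarith
        have h7 : z - 1 ≠ 0 := norm_pos_iff.1 (by linarith)
        have h8 := Complex.Gamma_add_one (z - 1) h7
        rw [sub_add_cancel] at h8
        rw [h8, mul_inv, norm_mul, norm_inv]
        calc ‖z - 1‖⁻¹ * ‖(Complex.Gamma (z - 1))⁻¹‖ ≤ 1 * max M 0 := by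
              gcongr
              exact inv_le_one_of_one_le₀ h6
          _ = _ := one_mul _
  refine ⟨max M 0, le_max_right _ _, fun z h1 h2 => ?_⟩
  obtain ⟨m, hm⟩ := exists_nat_ge z.re
  exact key m z h1 (by linarith) h2

/-! ### Powers on vertical lines and Laplace inversion -/

theorem mul_one_add_abs_le_norm {c : ℝ} (hc : 0 < c) (hc1 : c ≤ 1) (y : ℝ) :
    c / 2 * (1 + |y|) ≤ ‖(c : ℂ) + y * Complex.I‖ := by
  have h1 := Complex.abs_re_le_norm ((c : ℂ) + y * Complex.I)
  have h2 := Complex.abs_im_le_norm ((c : ℂ) + y * Complex.I)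
  simp at h1 h2
  have h3 := le_abs_self c
  nlinarith [abs_nonneg y]

theorem norm_vertical_rpow_neg_le {c : ℝ} (hc : 0 < c) (hc1 : c ≤ 1) {p : ℝ} (hp : 0 ≤ p) (y : ℝ) :
    ‖(c : ℂ) + y * Complex.I‖ ^ (-p) ≤ (c / 2) ^ (-p) * (1 + |y|) ^ (-p) := by
  rw [← Real.mul_rpow (by positivity) (by positivity)]
  exact Real.rpow_le_rpow_of_nonpos (by positivity) (mul_one_add_abs_le_norm hc hc1 y)
    (by linarith)

theorem integrable_one_add_abs_rpow_neg {p : ℝ} (hp : 1 < p) :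
    Integrable (fun y : ℝ => (1 + |y|) ^ (-p)) := by
  simpa using integrable_one_add_norm (E := ℝ) (μ := volume) (r := p) (by simpa using hp)

theorem vertical_mem_slitPlane {c : ℝ} (hc : 0 < c) (y : ℝ) :
    (c : ℂ) + y * Complex.I ∈ Complex.slitPlane := Or.inl (by simpa using hc)

theorem continuous_vertical_cpow {c : ℝ} (hc : 0 < c) (a : ℂ) :
    Continuous (fun y : ℝ => ((c : ℂ) + y * Complex.I) ^ a) :=
  Continuous.cpow (by fun_prop) continuous_const (vertical_mem_slitPlane hc)

/-- The dependence on `c` is kept explicit because the abscissa is later chosen as `x⁻¹` to bound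
the series for large `x`. -/
theorem norm_vertical_cpow_neg_le {c : ℝ} (hc : 0 < c) (hc1 : c ≤ 1) {a : ℂ} (ha : 0 ≤ a.re)
    (y : ℝ) : ‖((c : ℂ) + y * Complex.I) ^ (-a)‖ ≤
      (c / 2) ^ (-a.re) * Real.exp (Real.pi * |a.im|) * (1 + |y|) ^ (-a.re) := by
  refine (Complex.norm_cpow_le_rpow_mul_exp _ _).trans ?_
  rw [Complex.neg_re, Complex.neg_im, abs_neg, mul_right_comm]
  gcongr
  exact norm_vertical_rpow_neg_le hc hc1 ha y

theorem integrable_vertical_cpow_neg {c : ℝ} (hc : 0 < c) (hc1 : c ≤ 1) {a : ℂ} (ha : 1 < a.re) :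
    Integrable (fun y : ℝ => ((c : ℂ) + y * Complex.I) ^ (-a)) :=
  ((integrable_one_add_abs_rpow_neg ha).const_mul _).mono'
    (continuous_vertical_cpow hc _).aestronglyMeasurable
    (Eventually.of_forall fun y => norm_vertical_cpow_neg_le hc hc1 (by linarith) y)

/-- Laplace inversion for powers: `(2π)⁻¹ ∫ v^(-a) e^{xv} dy = x^(a-1) / Γ(a)` along the vertical
line `v = c + iy`. -/
theorem integral_vertical_cpow_neg_mul_cexp {c x : ℝ} (hc : 0 < c) (hc1 : c ≤ 1) (hx : 0 < x)
    {a : ℂ} (ha : 1 < a.re) :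
    ((2 * Real.pi : ℝ) : ℂ)⁻¹ * ∫ y : ℝ, ((c : ℂ) + y * Complex.I) ^ (-a) *
      Complex.exp (x * ((c : ℂ) + y * Complex.I)) = (x : ℂ) ^ (a - 1) * (Complex.Gamma a)⁻¹ := by
  have ha0 : 0 < a.re := by linarith
  have hG : Complex.Gamma a ≠ 0 := Complex.Gamma_ne_zero_of_re_pos ha0
  -- The Fourier transform of this one-sided function is `v^{-a} Γ(a)` on the line, integrable
  -- because `1 < Re a`; Fourier inversion at the continuity point `x` is the claim, after rescaling
  -- by `2π`.
  set f : ℝ → ℂ := (Set.Ioi 0).indicator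
    (fun t : ℝ => (t : ℂ) ^ (a - 1) * Complex.exp (-(c : ℂ) * t)) with hf
  have hfi : Integrable f :=
    (integrable_indicator_iff measurableSet_Ioi).2 (integrableOn_cpow_mul_cexp ha0 (by simpa using hc))
  have hF : FourierTransform.fourier f = fun w : ℝ =>
      ((c : ℂ) + ((2 * Real.pi * w : ℝ) : ℂ) * Complex.I) ^ (-a) * Complex.Gamma a := by
    ext w
    rw [Real.fourier_eq', ← integral_cpow_mul_cexp ha0 (by simpa using hc),
      ← integral_indicator measurableSet_Ioi]
    congr 1 with t
    by_cases ht : t ∈ Set.Ioi (0 : ℝ)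
    · rw [Set.indicator_of_mem ht, hf, Set.indicator_of_mem ht, smul_eq_mul, mul_left_comm,
        ← Complex.exp_add]
      congr 2
      simp
      ring
    · rw [Set.indicator_of_notMem ht, hf, Set.indicator_of_notMem ht, smul_zero]
  have hFi : Integrable (FourierTransform.fourier f) := by
    rw [hF]
    exact ((integrable_vertical_cpow_neg hc hc1 ha).comp_mul_left' (R := 2 * Real.pi)
      (by positivity)).mul_const _
  have hcont : ContinuousAt f x := by
    have h1 : ContinuousAt (fun t : ℝ => (t : ℂ) ^ (a - 1) * Complex.exp (-(c : ℂ) * t)) x := by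
      refine ContinuousAt.mul (ContinuousAt.cpow (by fun_prop) continuousAt_const
        (Or.inl (by simpa using hx))) (by fun_prop)
    refine h1.congr ?_
    filter_upwards [Ioi_mem_nhds hx] with t ht
    rw [hf, Set.indicator_of_mem ht]
  have key := hfi.fourierInv_fourier_eq hFi hcont
  rw [Real.fourierInv_eq', hF, hf, Set.indicator_of_mem (show x ∈ Set.Ioi 0 from hx)] at key
  have hsub := MeasureTheory.Measure.integral_comp_mul_left (fun y : ℝ =>
    ((c : ℂ) + y * Complex.I) ^ (-a) * Complex.exp (x * ((c : ℂ) + y * Complex.I))) (2 * Real.pi)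
  rw [abs_of_pos (by positivity), Complex.real_smul, Complex.ofReal_inv] at hsub
  rw [← hsub, eq_mul_inv_iff_mul_eq₀ hG, ← integral_mul_const]
  have hexp : Complex.exp (c * x) ≠ 0 := Complex.exp_ne_zero _
  calc _ = ∫ w : ℝ, Complex.exp (c * x) * (Complex.exp (((2 * Real.pi * inner ℝ w x : ℝ) : ℂ) *
        Complex.I) • (((c : ℂ) + ((2 * Real.pi * w : ℝ) : ℂ) * Complex.I) ^ (-a) *
          Complex.Gamma a)) := by
        congr 1 with w
        have h : (x : ℂ) * ((c : ℂ) + ((2 * Real.pi * w : ℝ) : ℂ) * Complex.I) =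
            c * x + ((2 * Real.pi * inner ℝ w x : ℝ) : ℂ) * Complex.I := by
          simp; ring
        rw [h, Complex.exp_add, smul_eq_mul]
        ring
    _ = _ := by
        rw [integral_const_mul, key, mul_left_comm, ← Complex.exp_add]
        simp

/-! ### The Bessel series: holomorphy, contour integral, polynomial bounds -/

/-- The power series `∑ (-1)^r x^r / (r! Γ(s+r+1))`, entire in both variables, so that
`J_s(ρ) = (ρ/2)^s besselSeries s (ρ²/4)`. -/
def besselSeries (s : ℂ) (x : ℝ) : ℂ :=
  ∑' r : ℕ, (-1 : ℂ) ^ r / ((r.factorial : ℂ) * Complex.Gamma (s + r + 1)) * (x : ℂ) ^ r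

theorem exists_norm_besselSeries_term_le {A : ℝ} (hA : 0 ≤ A) (B : ℝ) :
    ∃ M : ℝ, 0 ≤ M ∧ ∀ s : ℂ, -A ≤ s.re → |s.im| ≤ B → ∀ (x : ℝ) (r : ℕ),
      ‖(-1 : ℂ) ^ r / ((r.factorial : ℂ) * Complex.Gamma (s + r + 1)) * (x : ℂ) ^ r‖ ≤
        M * (|x| ^ r / (r.factorial : ℝ)) := by
  obtain ⟨M, hM0, hM⟩ := exists_norm_inv_Gamma_le hA B
  refine ⟨M, hM0, fun s h1 h2 x r => ?_⟩
  have h3 := hM (s + r + 1) (by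
    simp only [Complex.add_re, Complex.natCast_re, Complex.one_re]
    linarith [(Nat.cast_nonneg r : (0 : ℝ) ≤ r)]) (by simpa using h2)
  rw [norm_mul, norm_div, norm_mul, norm_pow, norm_neg, norm_one, one_pow, Complex.norm_natCast,
    norm_pow, Complex.norm_real, Real.norm_eq_abs, one_div, mul_inv, ← norm_inv (Complex.Gamma _)]
  calc ((r.factorial : ℝ))⁻¹ * ‖(Complex.Gamma (s + r + 1))⁻¹‖ * |x| ^ r
      ≤ ((r.factorial : ℝ))⁻¹ * M * |x| ^ r := by gcongr
    _ = _ := by ring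

theorem summable_besselSeries_term (s : ℂ) (x : ℝ) :
    Summable fun r : ℕ =>
      (-1 : ℂ) ^ r / ((r.factorial : ℂ) * Complex.Gamma (s + r + 1)) * (x : ℂ) ^ r := by
  obtain ⟨M, -, hM⟩ := exists_norm_besselSeries_term_le (abs_nonneg s.re) |s.im|
  exact Summable.of_norm_bounded ((Real.summable_pow_div_factorial |x|).mul_left M)
    fun r => hM s (neg_abs_le _) le_rfl x r

theorem exists_norm_besselSeries_le_exp {A : ℝ} (hA : 0 ≤ A) (B : ℝ) :
    ∃ M : ℝ, 0 ≤ M ∧ ∀ s : ℂ, -A ≤ s.re → |s.im| ≤ B → ∀ x : ℝ,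
      ‖besselSeries s x‖ ≤ M * Real.exp |x| := by
  obtain ⟨M, hM0, hM⟩ := exists_norm_besselSeries_term_le hA B
  refine ⟨M, hM0, fun s h1 h2 x => ?_⟩
  refine tsum_of_norm_bounded ?_ (hM s h1 h2 x)
  rw [Real.exp_eq_exp_ℝ]
  exact (NormedSpace.expSeries_div_hasSum_exp |x|).mul_left M

theorem differentiable_besselSeries (x : ℝ) : Differentiable ℂ fun s => besselSeries s x := by
  intro s
  obtain ⟨M, -, hM⟩ := exists_norm_besselSeries_term_le (A := |s.re| + 1) (by positivity) (|s.im| + 1)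
  set U : Set ℂ := Metric.ball s 1
  have hU : ∀ w ∈ U, -(|s.re| + 1) ≤ w.re ∧ |w.im| ≤ |s.im| + 1 := by
    intro w hw
    have h : ‖w - s‖ < 1 := by simpa [U, dist_eq_norm] using hw
    have h1 := (Complex.abs_re_le_norm (w - s)).trans h.le
    have h2 := (Complex.abs_im_le_norm (w - s)).trans h.le
    rw [Complex.sub_re] at h1
    rw [Complex.sub_im] at h2
    constructor
    · linarith [(abs_le.1 h1).1, neg_abs_le s.re]
    · linarith [abs_sub_abs_le_abs_sub w.im s.im]
  have := Complex.differentiableOn_tsum_of_summable_norm (U := U)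
    (F := fun (r : ℕ) (s : ℂ) =>
      (-1 : ℂ) ^ r / ((r.factorial : ℂ) * Complex.Gamma (s + r + 1)) * (x : ℂ) ^ r)
    ((Real.summable_pow_div_factorial |x|).mul_left M) (fun r => ?_) Metric.isOpen_ball
    (fun r w hw => hM w (hU w hw).1 (hU w hw).2 x r)
  · exact this.differentiableAt (Metric.ball_mem_nhds s one_pos)
  · have h1 : Differentiable ℂ fun s : ℂ => (Complex.Gamma (s + r + 1))⁻¹ :=
      Complex.differentiable_one_div_Gamma.comp (by fun_prop : Differentiable ℂ fun s : ℂ => s + r + 1)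
    simp only [div_eq_mul_inv, mul_inv]
    exact (((h1.const_mul _).const_mul _).mul_const _).differentiableOn

theorem continuous_besselSeries (s : ℂ) : Continuous (besselSeries s) := by
  obtain ⟨M, hM0, hM⟩ := exists_norm_besselSeries_term_le (abs_nonneg s.re) |s.im|
  refine continuous_iff_continuousAt.2 fun x => ?_
  have : ContinuousOn (besselSeries s) (Set.Ioo (x - 1) (x + 1)) := by
    refine continuousOn_tsum (fun r => by fun_prop)
      ((Real.summable_pow_div_factorial (|x| + 1)).mul_left M) fun r y hy => ?_
    refine (hM s (neg_abs_le _) le_rfl y r).trans ?_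
    have : |y| ≤ |x| + 1 := by
      have h : |y - x| ≤ 1 := abs_le.2 ⟨by linarith [hy.1], by linarith [hy.2]⟩
      linarith [abs_sub_abs_le_abs_sub y x]
    gcongr
  exact this.continuousAt (Ioo_mem_nhds (by linarith) (by linarith))

/-- Comparing coefficients of `x^(r+1)`, this is `(s+1) + (r+1) = s+r+2` together with `1/Γ(z) =
z/Γ(z+1)`. It carries bounds from `s+1` and `s+2` down to `s`. -/
theorem besselSeries_eq (s : ℂ) (x : ℝ) :
    besselSeries s x = (s + 1) * besselSeries (s + 1) x - x * besselSeries (s + 2) x := by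
  have h0 := summable_besselSeries_term s x
  have h1 := summable_besselSeries_term (s + 1) x
  have h2 := summable_besselSeries_term (s + 2) x
  rw [eq_sub_iff_add_eq]
  unfold besselSeries
  rw [← tsum_mul_left, ← tsum_mul_left, h0.tsum_eq_zero_add, (h1.mul_left (s + 1)).tsum_eq_zero_add,
    add_assoc, ← ((summable_nat_add_iff 1).2 h0).tsum_add (h2.mul_left _)]
  -- True for every `z`, since `Γ` takes the value `0` at its poles.
  have hG : ∀ z : ℂ, (Complex.Gamma z)⁻¹ = z * (Complex.Gamma (z + 1))⁻¹ := by
    intro z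
    rcases eq_or_ne z 0 with rfl | hz
    · simp
    · rw [Complex.Gamma_add_one z hz, mul_inv, mul_inv_cancel_left₀ hz]
  congr 1
  · simp only [Nat.cast_zero, add_zero, pow_zero, Nat.factorial_zero, Nat.cast_one, one_mul, mul_one,
      one_div]
    exact hG (s + 1)
  · congr 1 with r
    have hr : ((r : ℂ) + 1) ≠ 0 := by exact_mod_cast Nat.succ_ne_zero r
    have hf : (r.factorial : ℂ) ≠ 0 := by exact_mod_cast r.factorial_ne_zero
    have e1 : s + 1 + ((r + 1 : ℕ) : ℂ) + 1 = s + r + 3 := by push_cast; ring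
    have e2 : s + 2 + (r : ℂ) + 1 = s + r + 3 := by ring
    have e3 : (Complex.Gamma (s + ((r + 1 : ℕ) : ℂ) + 1))⁻¹ =
        (s + r + 2) * (Complex.Gamma (s + r + 3))⁻¹ := by
      rw [show s + ((r + 1 : ℕ) : ℂ) + 1 = s + r + 2 by push_cast; ring, hG,
        show s + r + 2 + 1 = s + (r : ℂ) + 3 by ring]
    simp only [div_eq_mul_inv, mul_inv]
    rw [e1, e2, e3, Nat.factorial_succ]
    push_cast
    field_simp
    ring

theorem norm_cexp_neg_inv_le_one {v : ℂ} (hv : 0 ≤ v.re) : ‖Complex.exp (-v⁻¹)‖ ≤ 1 := by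
  rw [Complex.norm_exp, Real.exp_le_one_iff, Complex.neg_re, Complex.inv_re]
  have := div_nonneg hv (Complex.normSq_nonneg v)
  linarith

/-- Expanding `e^{-1/v}` in powers of `1/v`, each `v^{-(s+r+1)}` is a Laplace inversion yielding
`x^(s+r)/Γ(s+r+1)`. Sum and integral commute because `|1/v| ≤ 1/c` on the line and `v^{-(s+1)}` is
integrable there for `Re s > 0`. -/
theorem cpow_mul_besselSeries_eq_integral {c x : ℝ} (hc : 0 < c) (hc1 : c ≤ 1) (hx : 0 < x)
    {s : ℂ} (hs : 0 < s.re) :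
    (x : ℂ) ^ s * besselSeries s x = ((2 * Real.pi : ℝ) : ℂ)⁻¹ * ∫ y : ℝ,
      ((c : ℂ) + y * Complex.I) ^ (-(s + 1)) * Complex.exp (x * ((c : ℂ) + y * Complex.I)) *
        Complex.exp (-((c : ℂ) + y * Complex.I)⁻¹) := by
  set v : ℝ → ℂ := fun y => (c : ℂ) + y * Complex.I with hv
  have hv0 : ∀ y, v y ≠ 0 := fun y => Complex.slitPlane_ne_zero (vertical_mem_slitPlane hc y)
  have hvc : Continuous v := by fun_prop
  have hvn : ∀ y, ‖(v y)⁻¹‖ ≤ c⁻¹ := by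
    intro y
    rw [norm_inv]
    gcongr
    have := Complex.abs_re_le_norm (v y)
    simp [hv] at this
    exact (le_abs_self c).trans this
  set h : ℝ → ℂ := fun y => v y ^ (-(s + 1)) * Complex.exp (x * v y) with hh
  have hexp : ∀ y, ‖Complex.exp (x * v y)‖ = Real.exp (x * c) := by
    intro y; rw [Complex.norm_exp]; simp [hv]
  have hhi : Integrable h := by
    refine (integrable_vertical_cpow_neg hc hc1 (a := s + 1) (by simpa using hs)).mul_bdd
      (c := Real.exp (x * c)) (by fun_prop) (Eventually.of_forall fun y => (hexp y).le)
  set F : ℕ → ℝ → ℂ := fun r y => ((-1 : ℂ) ^ r / r.factorial * (v y)⁻¹ ^ r) * h y with hF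
  have hFn : ∀ r y, ‖F r y‖ ≤ c⁻¹ ^ r / r.factorial * ‖h y‖ := by
    intro r y
    rw [hF]
    simp only [norm_mul, norm_div, norm_pow, norm_neg, norm_one, one_pow, Complex.norm_natCast]
    have := hvn y
    calc 1 / (r.factorial : ℝ) * ‖(v y)⁻¹‖ ^ r * ‖h y‖
        ≤ 1 / (r.factorial : ℝ) * c⁻¹ ^ r * ‖h y‖ := by gcongr
      _ = _ := by ring
  have hvi : Continuous fun y => (v y)⁻¹ := hvc.inv₀ hv0
  have hFi : ∀ r, Integrable (F r) := fun r =>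
    (hhi.norm.const_mul _).mono' (by
      exact (by fun_prop : AEStronglyMeasurable (fun y => (-1 : ℂ) ^ r / r.factorial * (v y)⁻¹ ^ r)
        volume).mul hhi.aestronglyMeasurable) (Eventually.of_forall (hFn r))
  have hsum := hasSum_integral_of_summable_integral_norm hFi (by
    refine Summable.of_nonneg_of_le (fun r => by positivity) (fun r => ?_)
      ((Real.summable_pow_div_factorial c⁻¹).mul_right (∫ y, ‖h y‖))
    rw [← integral_const_mul]
    exact integral_mono (hFi r).norm (hhi.norm.const_mul _) (hFn r))
  have hlim : (fun y => ∑' r, F r y) = fun y => h y * Complex.exp (-(v y)⁻¹) := by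
    ext y
    rw [hF, tsum_mul_right, mul_comm]
    congr 1
    rw [Complex.exp_eq_exp_ℂ, NormedSpace.exp_eq_tsum_div]
    congr 1 with r
    rw [neg_pow]
    ring
  rw [hlim] at hsum
  rw [← hsum.tsum_eq, ← tsum_mul_left, besselSeries, ← tsum_mul_left]
  congr 1 with r
  have key := integral_vertical_cpow_neg_mul_cexp hc hc1 hx (a := s + r + 1) (by
    simp; positivity)
  have hFr : F r = fun y => ((-1 : ℂ) ^ r / r.factorial) *
      (v y ^ (-(s + r + 1)) * Complex.exp (x * v y)) := by
    ext y
    have : v y ^ (-(s + r + 1)) = (v y)⁻¹ ^ r * v y ^ (-(s + 1)) := by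
      rw [show -(s + r + 1) = -(r : ℂ) + -(s + 1) by ring, Complex.cpow_add _ _ (hv0 y),
        Complex.cpow_neg, Complex.cpow_natCast, inv_pow]
    rw [hF, hh, this]
    ring
  rw [hFr, integral_const_mul, mul_left_comm (((2 * Real.pi : ℝ) : ℂ)⁻¹)]
  simp only [hv]
  rw [key, show s + r + 1 - 1 = s + r by ring,
    Complex.cpow_add _ _ (by exact_mod_cast hx.ne'), Complex.cpow_natCast]
  simp only [div_eq_mul_inv, mul_inv]
  ring

/-- For `x ≥ 1` the contour integral is taken on `Re v = 1/x`, where `|e^{xv}| = e`: the integral is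
`O(x^{Re s + 1})`, and dividing by `x^{Re s}` leaves one power of `x`. For `x ≤ 1` the exponential
bound suffices. -/
theorem exists_norm_besselSeries_le_of_re_pos {a : ℝ} (ha : 0 < a) (b B : ℝ) :
    ∃ C : ℝ, 0 ≤ C ∧ ∀ s : ℂ, a ≤ s.re → s.re ≤ b → |s.im| ≤ B → ∀ x : ℝ, 0 ≤ x →
      ‖besselSeries s x‖ ≤ C * (1 + x) := by
  obtain ⟨M, hM0, hM⟩ := exists_norm_besselSeries_le_exp le_rfl B
  set K : ℝ := ∫ y : ℝ, (1 + |y|) ^ (-(a + 1)) with hK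
  have hKi := integrable_one_add_abs_rpow_neg (p := a + 1) (by linarith)
  have hK0 : 0 ≤ K := integral_nonneg fun y => by positivity
  set D : ℝ := (2 * Real.pi)⁻¹ * (2 ^ (b + 1) * Real.exp (Real.pi * B) * Real.exp 1 * K) with hD
  have hD0 : 0 ≤ D := by positivity
  refine ⟨M * Real.exp 1 + D, by positivity, fun s h1 h2 h3 x hx => ?_⟩
  rcases le_total x 1 with hx1 | hx1
  · calc ‖besselSeries s x‖ ≤ M * Real.exp |x| := hM s (by linarith) h3 x
      _ ≤ M * Real.exp 1 := by gcongr; rwa [abs_of_nonneg hx]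
      _ = M * Real.exp 1 * 1 := (mul_one _).symm
      _ ≤ _ := by gcongr <;> linarith
  · have hx0 : 0 < x := by linarith
    have hc0 : 0 < x⁻¹ := by positivity
    have hc1 : x⁻¹ ≤ 1 := inv_le_one_of_one_le₀ hx1
    have key := congrArg norm (cpow_mul_besselSeries_eq_integral hc0 hc1 hx0 (s := s) (by linarith))
    rw [norm_mul, norm_mul, Complex.norm_cpow_eq_rpow_re_of_pos hx0, norm_inv, Complex.norm_real,
      Real.norm_eq_abs, abs_of_pos (by positivity : 0 < 2 * Real.pi)] at key
    have hint : ‖∫ y : ℝ, (((x⁻¹ : ℝ) : ℂ) + y * Complex.I) ^ (-(s + 1)) *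
        Complex.exp (x * (((x⁻¹ : ℝ) : ℂ) + y * Complex.I)) *
        Complex.exp (-(((x⁻¹ : ℝ) : ℂ) + y * Complex.I)⁻¹)‖ ≤
        x ^ (s.re + 1) * (2 ^ (b + 1) * Real.exp (Real.pi * B) * Real.exp 1 * K) := by
      have e : x ^ (s.re + 1) * (2 ^ (b + 1) * Real.exp (Real.pi * B) * Real.exp 1 * K) =
          ∫ y : ℝ, x ^ (s.re + 1) * (2 ^ (b + 1) * Real.exp (Real.pi * B) * Real.exp 1) *
            (1 + |y|) ^ (-(a + 1)) := by
        rw [integral_const_mul, hK]; ring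
      rw [e]
      refine norm_integral_le_of_norm_le (hKi.const_mul _) (Eventually.of_forall fun y => ?_)
      rw [norm_mul, norm_mul, Complex.norm_exp]
      have i1 := norm_vertical_cpow_neg_le hc0 hc1 (a := s + 1)
        (by simp only [Complex.add_re, Complex.one_re]; linarith) y
      have i2 : ((x : ℂ) * (((x⁻¹ : ℝ) : ℂ) + y * Complex.I)).re = 1 := by
        simp [hx0.ne']
      have i3 := norm_cexp_neg_inv_le_one (v := ((x⁻¹ : ℝ) : ℂ) + y * Complex.I)
        (by simpa using hx)
      have i4 : (x⁻¹ / 2) ^ (-(s + 1).re) ≤ x ^ (s.re + 1) * 2 ^ (b + 1) := by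
        rw [Real.rpow_neg (by positivity), ← Real.inv_rpow (by positivity), inv_div, div_inv_eq_mul,
          mul_comm, Real.mul_rpow hx (by norm_num), Complex.add_re, Complex.one_re]
        gcongr
        norm_num
      have i5 : (1 + |y|) ^ (-(s + 1).re) ≤ (1 + |y|) ^ (-(a + 1)) := by
        refine Real.rpow_le_rpow_of_exponent_le (by simp) ?_
        simp only [Complex.add_re, Complex.one_re]; linarith
      have i6 : |(s + 1).im| ≤ B := by simpa using h3
      rw [i2]
      calc _ ≤ ((x⁻¹ / 2) ^ (-(s + 1).re) * Real.exp (Real.pi * |(s + 1).im|) *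
            (1 + |y|) ^ (-(s + 1).re)) * Real.exp 1 * 1 := by gcongr
        _ ≤ ((x ^ (s.re + 1) * 2 ^ (b + 1)) * Real.exp (Real.pi * B) *
            (1 + |y|) ^ (-(a + 1))) * Real.exp 1 * 1 := by gcongr
        _ = _ := by ring
    have hxs : 0 < x ^ s.re := by positivity
    have : x ^ s.re * ‖besselSeries s x‖ ≤ x ^ s.re * (D * x) := by
      rw [key]
      calc _ ≤ (2 * Real.pi)⁻¹ * (x ^ (s.re + 1) *
            (2 ^ (b + 1) * Real.exp (Real.pi * B) * Real.exp 1 * K)) := by gcongr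
        _ = _ := by rw [Real.rpow_add_one hx0.ne', hD]; ring
    have h5 := le_of_mul_le_mul_left this hxs
    have h6 : 0 ≤ M * Real.exp 1 * (1 + x) := by positivity
    nlinarith

/-- Each application of the recurrence moves the admissible real part one unit to the left, at the
price of one factor `1 + x`. The rate is far from sharp, but polynomial growth is all that
temperedness needs. -/
theorem exists_norm_besselSeries_le (m : ℕ) :
    ∀ {a : ℝ}, -m < a → ∀ b B : ℝ,
    ∃ C : ℝ, 0 ≤ C ∧ ∀ s : ℂ, a ≤ s.re → s.re ≤ b → |s.im| ≤ B → ∀ x : ℝ, 0 ≤ x →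
      ‖besselSeries s x‖ ≤ C * (1 + x) ^ (m + 1) := by
  induction m with
  | zero =>
    intro a ha b B
    simpa using exists_norm_besselSeries_le_of_re_pos (by simpa using ha) b B
  | succ m ih =>
    intro a ha b B
    push_cast at ha
    obtain ⟨C, hC0, hC⟩ := ih (a := a + 1) (by linarith) (b + 2) B
    refine ⟨(|a| + |b| + |B| + 2) * C, by positivity, fun s h1 h2 h3 x hx => ?_⟩
    rw [besselSeries_eq]
    have j1 := hC (s + 1) (by simpa using h1) (by simp; linarith) (by simpa using h3) x hx
    have j2 := hC (s + 2) (by simp; linarith) (by simpa using h2) (by simpa using h3) x hx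
    have j3 : ‖s + 1‖ ≤ |a| + |b| + |B| + 1 := by
      refine (norm_add_le _ _).trans ?_
      rw [norm_one]
      gcongr
      refine (Complex.norm_le_abs_re_add_abs_im s).trans (add_le_add ?_ ?_)
      · refine abs_le.2 ⟨?_, ?_⟩
        · linarith [neg_abs_le a, abs_nonneg b]
        · linarith [le_abs_self b, abs_nonneg a]
      · exact h3.trans (le_abs_self B)
    calc _ ≤ ‖s + 1‖ * ‖besselSeries (s + 1) x‖ + x * ‖besselSeries (s + 2) x‖ := by
          refine (norm_sub_le _ _).trans ?_
          rw [norm_mul, norm_mul, Complex.norm_real, Real.norm_eq_abs, abs_of_nonneg hx]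
      _ ≤ (|a| + |b| + |B| + 1) * (C * (1 + x) ^ (m + 1)) + x * (C * (1 + x) ^ (m + 1)) := by
          gcongr
      _ = (|a| + |b| + |B| + 1 + x) * (C * (1 + x) ^ (m + 1)) := by ring
      _ ≤ ((|a| + |b| + |B| + 2) * (1 + x)) * (C * (1 + x) ^ (m + 1)) := by
          gcongr
          nlinarith [abs_nonneg a, abs_nonneg b, abs_nonneg B]
      _ = _ := by ring

/-- The prefactor `ρ^s` and the `(ρ/2)^s` inside `J_s` combine to `2^s (ρ²/4)^s`, exactly the power
produced by the contour formula at `x = ρ²/4`. -/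
theorem cpow_mul_besselJ_eq (s : ℂ) {ρ : ℝ} (hρ : 0 < ρ) :
    (ρ : ℂ) ^ s * besselJ s ρ =
      (2 : ℂ) ^ s * (((ρ ^ 2 / 4 : ℝ) : ℂ) ^ s * besselSeries s (ρ ^ 2 / 4)) := by
  have hρ2 : ((ρ / 2 : ℝ) : ℂ) ≠ 0 := by exact_mod_cast (by positivity : ρ / 2 ≠ 0)
  have e1 : besselJ s ρ = ((ρ / 2 : ℝ) : ℂ) ^ s * besselSeries s (ρ ^ 2 / 4) := by
    rw [besselJ, besselSeries, ← tsum_mul_left]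
    congr 1 with r
    have : ((ρ : ℂ) / 2) ^ (s + 2 * (r : ℂ)) =
        ((ρ / 2 : ℝ) : ℂ) ^ s * ((ρ ^ 2 / 4 : ℝ) : ℂ) ^ r := by
      rw [show (ρ : ℂ) / 2 = ((ρ / 2 : ℝ) : ℂ) by push_cast; rfl, Complex.cpow_add _ _ hρ2,
        show (2 : ℂ) * (r : ℂ) = ((2 * r : ℕ) : ℂ) by push_cast; rfl, Complex.cpow_natCast, pow_mul]
      congr 2
      push_cast
      ring
    rw [this]
    ring
  have e2 : (ρ : ℂ) ^ s = (2 : ℂ) ^ s * ((ρ / 2 : ℝ) : ℂ) ^ s := by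
    have := Complex.mul_cpow_ofReal_nonneg (a := 2) (b := ρ / 2) (by norm_num) (by positivity) s
    rw [← Complex.ofReal_mul, mul_div_cancel₀ ρ two_ne_zero] at this
    simpa using this
  have e3 : ((ρ ^ 2 / 4 : ℝ) : ℂ) ^ s = ((ρ / 2 : ℝ) : ℂ) ^ s * ((ρ / 2 : ℝ) : ℂ) ^ s := by
    rw [← Complex.mul_cpow_ofReal_nonneg (by positivity) (by positivity), ← Complex.ofReal_mul]
    congr 2
    ring
  rw [e1, e2, e3]
  ring

/-! ### Tempered symbols, their inverse Fourier transforms and damping -/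

/-- `g` is integrable against a negative power of `1 + |ξ|`. -/
def IsTemperedIntegrable {n : ℕ} (g : EuclideanSpace ℝ (Fin n) → ℂ) : Prop :=
  ∃ N : ℕ, Integrable fun ξ => ((1 + ‖ξ‖) ^ N)⁻¹ • g ξ

section

variable {n : ℕ} {g : EuclideanSpace ℝ (Fin n) → ℂ}

theorem integrable_mul_of_decay {N : ℕ} (hg : Integrable fun ξ => ((1 + ‖ξ‖) ^ N)⁻¹ • g ξ)
    {h : EuclideanSpace ℝ (Fin n) → ℂ} (hh : Continuous h) {C : ℝ}
    (hC : ∀ ξ, (1 + ‖ξ‖) ^ N * ‖h ξ‖ ≤ C) :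
    Integrable (fun ξ => g ξ * h ξ) ∧
      ‖∫ ξ, g ξ * h ξ‖ ≤ C * ∫ ξ, ‖((1 + ‖ξ‖) ^ N)⁻¹ • g ξ‖ := by
  have e : (fun ξ => g ξ * h ξ) =
      fun ξ => (((1 + ‖ξ‖) ^ N)⁻¹ • g ξ) * ((1 + ‖ξ‖) ^ N • h ξ) := by
    ext ξ
    have : (1 + ‖ξ‖) ^ N ≠ 0 := by positivity
    rw [smul_mul_smul_comm, inv_mul_cancel₀ this, one_smul]
  have hb : ∀ ξ, ‖(1 + ‖ξ‖) ^ N • h ξ‖ ≤ C := by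
    intro ξ
    rw [norm_smul, Real.norm_of_nonneg (by positivity)]
    exact hC ξ
  rw [e]
  refine ⟨hg.mul_bdd (c := C) (by fun_prop) (Eventually.of_forall hb), ?_⟩
  rw [← integral_const_mul]
  refine norm_integral_le_of_norm_le (hg.norm.const_mul C) (Eventually.of_forall fun ξ => ?_)
  rw [norm_mul, mul_comm]
  gcongr
  exact hb ξ

theorem schwartz_decay (φ : 𝓢(EuclideanSpace ℝ (Fin n), ℂ)) (N : ℕ)
    (ξ : EuclideanSpace ℝ (Fin n)) :
    (1 + ‖ξ‖) ^ N * ‖φ ξ‖ ≤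
      2 ^ N * (Finset.Iic (N, 0)).sup (schwartzSeminormFamily ℂ _ ℂ) φ := by
  have := SchwartzMap.one_add_le_sup_seminorm_apply (𝕜 := ℂ) (m := (N, 0)) (k := N) (n := 0)
    le_rfl le_rfl φ ξ
  rw [norm_iteratedFDeriv_zero] at this
  exact this

theorem IsTemperedIntegrable.integrable_mul_schwartz (hg : IsTemperedIntegrable g)
    (φ : 𝓢(EuclideanSpace ℝ (Fin n), ℂ)) : Integrable fun ξ => g ξ * φ ξ := by
  obtain ⟨N, hN⟩ := hg
  exact (integrable_mul_of_decay hN φ.continuous (schwartz_decay φ N)).1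

/-- Integration against a function that is tempered-integrable. -/
def IsTemperedIntegrable.toCLM (hg : IsTemperedIntegrable g) :
    𝓢(EuclideanSpace ℝ (Fin n), ℂ) →L[ℂ] ℂ :=
  SchwartzMap.mkCLMtoNormedSpace (fun φ => ∫ ξ, g ξ * φ ξ)
    (fun φ χ => by
      simp only [_root_.add_apply, mul_add]
      exact integral_add (hg.integrable_mul_schwartz φ) (hg.integrable_mul_schwartz χ))
    (fun a φ => by
      simp only [_root_.smul_apply, smul_eq_mul, mul_left_comm, RingHom.id_apply]
      exact integral_const_mul _ _)
    (by
      obtain ⟨N, hN⟩ := hg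
      refine ⟨Finset.Iic (N, 0), 2 ^ N * ∫ ξ, ‖((1 + ‖ξ‖) ^ N)⁻¹ • g ξ‖, by positivity,
        fun φ => ?_⟩
      refine (integrable_mul_of_decay hN φ.continuous (schwartz_decay φ N)).2.trans ?_
      rw [mul_right_comm])

/-- The inverse Fourier transform, in the normalization `(2π)^(-n) ∫ e^{i⟨x,ξ⟩} φ(x) dx`, as a map
of Schwartz functions. -/
def invFourierCLM (n : ℕ) :
    𝓢(EuclideanSpace ℝ (Fin n), ℂ) →L[ℂ] 𝓢(EuclideanSpace ℝ (Fin n), ℂ) :=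
  ((2 * Real.pi : ℝ) : ℂ)⁻¹ ^ n •
    -- The library kernel is `e^{2πi⟨x,ξ⟩}`; evaluating at `ξ/(2π)` gives `e^{i⟨x,ξ⟩}`.
    (SchwartzMap.compCLMOfContinuousLinearEquiv ℂ
      (ContinuousLinearEquiv.smulLeft
        (Units.mk0 (2 * Real.pi)⁻¹ (by positivity : (2 * Real.pi)⁻¹ ≠ 0)))) ∘L
    FourierTransform.fourierInvCLM ℂ 𝓢(EuclideanSpace ℝ (Fin n), ℂ)

theorem invFourierCLM_apply (φ : 𝓢(EuclideanSpace ℝ (Fin n), ℂ))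
    (ξ : EuclideanSpace ℝ (Fin n)) :
    invFourierCLM n φ ξ = invFourierIntegral (fun x => φ x) ξ := by
  change ((2 * Real.pi : ℝ) : ℂ)⁻¹ ^ n •
    (FourierTransformInv.fourierInv φ) ((2 * Real.pi)⁻¹ • ξ) = _
  rw [SchwartzMap.fourierInv_coe, Real.fourierInv_eq', smul_eq_mul, invFourierIntegral]
  congr 2 with x
  rw [smul_eq_mul, real_inner_smul_right, mul_inv_cancel_left₀ (by positivity),
    real_inner_comm, mul_comm Complex.I]

/-- The inverse Fourier transform of the tempered distribution defined by `g`. -/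
def IsTemperedIntegrable.invFourier (hg : IsTemperedIntegrable g) :
    𝓢'(EuclideanSpace ℝ (Fin n), ℂ) :=
  ContinuousLinearMap.toPointwiseConvergenceCLM _ _ _ _ (hg.toCLM ∘L invFourierCLM n)

theorem IsTemperedIntegrable.invFourier_apply (hg : IsTemperedIntegrable g)
    (φ : 𝓢(EuclideanSpace ℝ (Fin n), ℂ)) :
    hg.invFourier φ = ∫ ξ, g ξ * invFourierCLM n φ ξ := rfl

theorem IsTemperedIntegrable.isInvFourierTransform (hg : IsTemperedIntegrable g) :
    IsInvFourierTransform g hg.invFourier := by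
  intro φ
  simp only [← invFourierCLM_apply]
  exact ⟨hg.integrable_mul_schwartz φ, hg.integrable_mul_schwartz _, rfl⟩

theorem continuous_invFourierIntegral {h : EuclideanSpace ℝ (Fin n) → ℂ} (hh : Integrable h) :
    Continuous (invFourierIntegral h) := by
  refine continuous_const.mul (continuous_of_dominated (bound := fun ξ => ‖h ξ‖)
    (fun x => ?_) (fun x => Eventually.of_forall fun ξ => ?_) hh.norm
    (Eventually.of_forall fun ξ => by fun_prop))
  · exact (by fun_prop : Continuous fun ξ : EuclideanSpace ℝ (Fin n) =>
      Complex.exp (Complex.I * ((inner ℝ x ξ : ℝ) : ℂ))).aestronglyMeasurable.mul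
      hh.aestronglyMeasurable
  · rw [norm_mul, mul_comm Complex.I, Complex.norm_exp_ofReal_mul_I, one_mul]

theorem norm_invFourierIntegral_le (h : EuclideanSpace ℝ (Fin n) → ℂ)
    (x : EuclideanSpace ℝ (Fin n)) :
    ‖invFourierIntegral h x‖ ≤ (2 * Real.pi)⁻¹ ^ n * ∫ ξ, ‖h ξ‖ := by
  rw [invFourierIntegral, norm_mul, norm_pow, norm_inv, Complex.norm_real, Real.norm_eq_abs,
    abs_of_pos (by positivity)]
  gcongr
  refine (norm_integral_le_integral_norm _).trans_eq ?_
  congr 1 with ξ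
  rw [norm_mul, mul_comm Complex.I, Complex.norm_exp_ofReal_mul_I, one_mul]

theorem integrable_invFourierIntegral_mul {h φ : EuclideanSpace ℝ (Fin n) → ℂ}
    (hh : Integrable h) (hφ : Integrable φ) :
    Integrable fun x => invFourierIntegral h x * φ x :=
  hφ.bdd_mul (continuous_invFourierIntegral hh).aestronglyMeasurable
    (Eventually.of_forall (norm_invFourierIntegral_le h))

theorem integral_invFourierIntegral_mul {h φ : EuclideanSpace ℝ (Fin n) → ℂ}
    (hh : Integrable h) (hφ : Integrable φ) :
    ∫ x, invFourierIntegral h x * φ x = ∫ ξ, h ξ * invFourierIntegral φ ξ := by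
  simp only [invFourierIntegral, mul_assoc, mul_left_comm _ (((2 * Real.pi : ℝ) : ℂ)⁻¹ ^ n),
    integral_const_mul]
  congr 1
  simp only [← integral_mul_const, ← integral_const_mul]
  rw [integral_integral_swap]
  · congr 1 with ξ
    congr 1 with x
    rw [real_inner_comm]
    ring
  · have h1 : Integrable (fun p : EuclideanSpace ℝ (Fin n) × EuclideanSpace ℝ (Fin n) =>
        φ p.1 * h p.2) (volume.prod volume) := hφ.mul_prod hh
    refine (h1.bdd_mul (c := 1) (f := fun p => Complex.exp (Complex.I * ((inner ℝ p.1 p.2 : ℝ) : ℂ)))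
      (by fun_prop) (Eventually.of_forall fun p => ?_)).congr
      (Eventually.of_forall fun p => ?_)
    · rw [mul_comm Complex.I, Complex.norm_exp_ofReal_mul_I]
    · simp only [Function.uncurry]
      ring

theorem one_add_pow_mul_exp_neg_le {ε : ℝ} (hε : 0 < ε) (N : ℕ) {t : ℝ} (ht : 0 ≤ t) :
    (1 + t) ^ N * Real.exp (-ε * t) ≤ N.factorial * Real.exp ε / ε ^ N := by
  have h := Real.pow_div_factorial_le_exp (ε * (1 + t)) (by positivity) N
  rw [div_le_iff₀ (by positivity), mul_pow, mul_add, mul_one, Real.exp_add] at h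
  rw [le_div_iff₀ (by positivity), neg_mul, Real.exp_neg]
  have h2 : 0 < Real.exp (ε * t) := Real.exp_pos _
  rw [mul_right_comm, ← div_eq_mul_inv, div_le_iff₀ h2]
  linarith

theorem IsTemperedIntegrable.integrable_damped (hg : IsTemperedIntegrable g) {ε : ℝ} (hε : 0 < ε) :
    Integrable (damped g ε) := by
  obtain ⟨N, hN⟩ := hg
  have := (integrable_mul_of_decay hN
    (h := fun ξ => ((Real.exp (-ε * ‖ξ‖) : ℝ) : ℂ)) (by fun_prop)
    (fun ξ => by
      rw [Complex.norm_real, Real.norm_of_nonneg (Real.exp_pos _).le]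
      exact one_add_pow_mul_exp_neg_le hε N (norm_nonneg ξ))).1
  exact this.congr (Eventually.of_forall fun ξ => mul_comm _ _)

/-- Fubini moves the inverse Fourier transform onto `φ`; the factor `e^{-ε|ξ|} ≤ 1` then disappears
by dominated convergence. -/
theorem IsTemperedIntegrable.isDampedInvFourierLimit (hg : IsTemperedIntegrable g) :
    IsDampedInvFourierLimit g hg.invFourier := by
  refine ⟨fun ε hε => hg.integrable_damped hε,
    fun ε hε φ => integrable_invFourierIntegral_mul (hg.integrable_damped hε) φ.integrable,
    fun φ => ?_⟩
  have hi := hg.integrable_mul_schwartz (invFourierCLM n φ)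
  rw [hg.invFourier_apply]
  have hlim : Tendsto (fun ε : ℝ => ∫ ξ, damped g ε ξ * invFourierCLM n φ ξ) (𝓝[>] 0)
      (𝓝 (∫ ξ, g ξ * invFourierCLM n φ ξ)) := by
    refine tendsto_integral_filter_of_dominated_convergence (fun ξ => ‖g ξ * invFourierCLM n φ ξ‖)
      ?_ ?_ hi.norm (Eventually.of_forall fun ξ => ?_)
    · filter_upwards [self_mem_nhdsWithin] with ε hε
      exact ((hg.integrable_damped hε).aestronglyMeasurable.mul
        (invFourierCLM n φ).continuous.aestronglyMeasurable)
    · filter_upwards [self_mem_nhdsWithin] with ε hε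
      refine Eventually.of_forall fun ξ => ?_
      have hε' : (0 : ℝ) < ε := hε
      rw [damped, mul_assoc, norm_mul, Complex.norm_real, Real.norm_of_nonneg (Real.exp_pos _).le]
      refine mul_le_of_le_one_left (norm_nonneg _) (Real.exp_le_one_iff.2 ?_)
      nlinarith [norm_nonneg ξ]
    · have : Continuous fun ε : ℝ => damped g ε ξ * invFourierCLM n φ ξ := by
        unfold damped; fun_prop
      have h0 := (this.tendsto 0).mono_left (nhdsWithin_le_nhds (s := Set.Ioi 0))
      simpa [damped] using h0
  refine hlim.congr' ?_
  filter_upwards [self_mem_nhdsWithin] with ε hε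
  rw [integral_invFourierIntegral_mul (hg.integrable_damped hε) φ.integrable]
  simp only [invFourierCLM_apply]

theorem integrable_cexp_neg_mul_sq_norm {b : ℂ} (hb : 0 < b.re) :
    Integrable fun ξ : EuclideanSpace ℝ (Fin n) => Complex.exp (-b * (‖ξ‖ : ℂ) ^ 2) := by
  simpa using GaussianFourier.integrable_cexp_neg_mul_sq_norm_add hb 0
    (0 : EuclideanSpace ℝ (Fin n))

theorem invFourierIntegral_gaussian {b : ℂ} (hb : 0 < b.re) (x : EuclideanSpace ℝ (Fin n)) :
    invFourierIntegral (fun ξ => Complex.exp (-b * (‖ξ‖ : ℂ) ^ 2)) x =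
      ((2 * Real.pi : ℝ) : ℂ)⁻¹ ^ n * (Real.pi / b) ^ ((n : ℂ) / 2) *
        Complex.exp (-(‖x‖ : ℂ) ^ 2 / (4 * b)) := by
  have h := GaussianFourier.integral_cexp_neg_mul_sq_norm_add hb Complex.I x
  rw [finrank_euclideanSpace, Fintype.card_fin, Complex.I_sq, neg_one_mul] at h
  rw [invFourierIntegral, mul_assoc, ← h]
  congr 2 with ξ
  rw [← Complex.exp_add, add_comm]

theorem integral_gaussian_mul_invFourierIntegral {b : ℂ} (hb : 0 < b.re)
    {φ : EuclideanSpace ℝ (Fin n) → ℂ} (hφ : Integrable φ) :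
    ∫ ξ, Complex.exp (-b * (‖ξ‖ : ℂ) ^ 2) * invFourierIntegral φ ξ =
      ((2 * Real.pi : ℝ) : ℂ)⁻¹ ^ n * (Real.pi / b) ^ ((n : ℂ) / 2) *
        ∫ x, Complex.exp (-(‖x‖ : ℂ) ^ 2 / (4 * b)) * φ x := by
  rw [← integral_invFourierIntegral_mul (integrable_cexp_neg_mul_sq_norm hb) hφ,
    ← integral_const_mul]
  congr 1 with x
  rw [invFourierIntegral_gaussian hb, mul_assoc]

end

/-! ### Integrability of radial weights -/

theorem integrableOn_Ioi_one_add_rpow_neg {p : ℝ} (hp : 1 < p) :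
    IntegrableOn (fun y : ℝ => (1 + y) ^ (-p)) (Set.Ioi 0) :=
  (integrable_one_add_abs_rpow_neg hp).integrableOn.congr_fun
    (fun y hy => by simp only [abs_of_pos (show (0 : ℝ) < y from hy)]) measurableSet_Ioi

theorem integrableOn_Ioi_rpow_mul_one_add_pow_inv {q : ℝ} {N : ℕ} (hq : -1 < q) (hN : q + 1 < N) :
    IntegrableOn (fun y : ℝ => y ^ q * ((1 + y) ^ N)⁻¹) (Set.Ioi 0) := by
  have hmeas : Measurable fun y : ℝ => y ^ q * ((1 + y) ^ N)⁻¹ := by fun_prop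
  have h1 : IntegrableOn (fun y : ℝ => y ^ q) (Set.Ioc 0 1) :=
    (intervalIntegrable_iff_integrableOn_Ioc_of_le zero_le_one).1
      (intervalIntegral.intervalIntegrable_rpow' hq)
  have h2 : IntegrableOn (fun y : ℝ => y ^ (q - N)) (Set.Ioi 1) :=
    integrableOn_Ioi_rpow_of_lt (by linarith) one_pos
  rw [← Set.Ioc_union_Ioi_eq_Ioi (zero_le_one (α := ℝ))]
  refine IntegrableOn.union (h1.mono' hmeas.aestronglyMeasurable ?_)
    (h2.mono' hmeas.aestronglyMeasurable ?_)
  · refine (ae_restrict_iff' measurableSet_Ioc).2 (Eventually.of_forall fun y hy => ?_)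
    have hy0 : 0 < y := hy.1
    rw [Real.norm_of_nonneg (by positivity)]
    refine mul_le_of_le_one_right (by positivity) (inv_le_one_of_one_le₀ (one_le_pow₀ (by linarith)))
  · refine (ae_restrict_iff' measurableSet_Ioi).2 (Eventually.of_forall fun y hy => ?_)
    have hy1 : 1 < y := hy
    have hy0 : 0 < y := by linarith
    rw [Real.norm_of_nonneg (by positivity), Real.rpow_sub hy0, Real.rpow_natCast, div_eq_mul_inv]
    gcongr
    linarith

theorem integrableOn_Ioi_abs_sub_one_rpow_neg_mul {a : ℝ} (ha0 : 0 ≤ a) (ha : a < 1) :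
    IntegrableOn (fun y : ℝ => |y - 1| ^ (-a) * (1 + y) ^ (-2 : ℝ)) (Set.Ioi 0) := by
  have hmeas : Measurable fun y : ℝ => |y - 1| ^ (-a) * (1 + y) ^ (-2 : ℝ) := by fun_prop
  have h0 : IntervalIntegrable (fun y : ℝ => |y| ^ (-a)) volume (-1) 1 := by
    have h : IntervalIntegrable (fun y : ℝ => |y| ^ (-a)) volume 0 1 :=
      (intervalIntegral.intervalIntegrable_rpow' (by linarith : -1 < -a)).congr (by
        rw [Set.uIoc_of_le zero_le_one]
        intro y hy
        simp only [abs_of_pos hy.1])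
    refine IntervalIntegrable.trans (b := 0) ?_ h
    have := (h.comp_mul_left (c := -1)).symm
    simpa using this
  have h1 : IntegrableOn (fun y : ℝ => |y - 1| ^ (-a)) (Set.Ioc 0 2) := by
    have := h0.comp_sub_right 1
    norm_num at this
    exact (intervalIntegrable_iff_integrableOn_Ioc_of_le zero_le_two).1 this
  rw [← Set.Ioc_union_Ioi_eq_Ioi (zero_le_two (α := ℝ))]
  refine IntegrableOn.union (h1.mono' hmeas.aestronglyMeasurable ?_)
    (((integrableOn_Ioi_one_add_rpow_neg one_lt_two).mono_set
      (Set.Ioi_subset_Ioi zero_le_two)).mono' hmeas.aestronglyMeasurable ?_)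
  · refine (ae_restrict_iff' measurableSet_Ioc).2 (Eventually.of_forall fun y hy => ?_)
    have hy0 : 0 < y := hy.1
    rw [Real.norm_of_nonneg (by positivity)]
    refine mul_le_of_le_one_right (by positivity)
      (Real.rpow_le_one_of_one_le_of_nonpos (by linarith) (by norm_num))
  · refine (ae_restrict_iff' measurableSet_Ioi).2 (Eventually.of_forall fun y hy => ?_)
    have hy2 : 2 < y := hy
    have hy0 : 0 < y := by linarith
    rw [Real.norm_of_nonneg (by positivity)]
    refine mul_le_of_le_one_left (by positivity)
      (Real.rpow_le_one_of_one_le_of_nonpos ?_ (by linarith))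
    rw [abs_of_pos (by linarith)]; linarith

section

variable {n : ℕ}

theorem integrable_norm_rpow_mul (hn : 1 ≤ n) {p : ℝ} {N : ℕ} (hp : -n < p) (hN : p + n < N) :
    Integrable fun ξ : EuclideanSpace ℝ (Fin n) => ‖ξ‖ ^ p * ((1 + ‖ξ‖) ^ N)⁻¹ := by
  have : Nontrivial (EuclideanSpace ℝ (Fin n)) := by
    have : Nonempty (Fin n) := ⟨⟨0, hn⟩⟩
    infer_instance
  rw [integrable_fun_norm_addHaar volume (f := fun y : ℝ => y ^ p * ((1 + y) ^ N)⁻¹),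
    finrank_euclideanSpace, Fintype.card_fin]
  have hc : ((n - 1 : ℕ) : ℝ) = n - 1 := by push_cast [Nat.cast_sub hn]; rfl
  refine (integrableOn_Ioi_rpow_mul_one_add_pow_inv (q := p + (n - 1 : ℕ)) (N := N)
    (by rw [hc]; linarith) (by rw [hc]; linarith)).congr_fun (fun y hy => ?_) measurableSet_Ioi
  have hy0 : (0 : ℝ) < y := hy
  simp only [smul_eq_mul]
  rw [Real.rpow_add hy0, Real.rpow_natCast]
  ring

/-- In polar coordinates `n - 1` of the factors `1 + r` absorb the Jacobian and two remain for
convergence at infinity; the singularity at `r = 1` is integrable as `a < 1`. -/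
theorem integrable_abs_norm_sq_sub_one_rpow_mul (hn : 1 ≤ n) {a : ℝ} (ha0 : 0 ≤ a) (ha : a < 1) :
    Integrable fun x : EuclideanSpace ℝ (Fin n) =>
      |‖x‖ ^ 2 - 1| ^ (-a) * ((1 + ‖x‖) ^ (n + 1))⁻¹ := by
  have : Nontrivial (EuclideanSpace ℝ (Fin n)) := by
    have : Nonempty (Fin n) := ⟨⟨0, hn⟩⟩
    infer_instance
  rw [integrable_fun_norm_addHaar volume
    (f := fun y : ℝ => |y ^ 2 - 1| ^ (-a) * ((1 + y) ^ (n + 1))⁻¹),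
    finrank_euclideanSpace, Fintype.card_fin]
  refine (integrableOn_Ioi_abs_sub_one_rpow_neg_mul ha0 ha).mono'
    (by fun_prop : Measurable fun y : ℝ =>
      y ^ (n - 1) • (|y ^ 2 - 1| ^ (-a) * ((1 + y) ^ (n + 1))⁻¹)).aestronglyMeasurable ?_
  refine (ae_restrict_iff' measurableSet_Ioi).2 (Eventually.of_forall fun y hy => ?_)
  have hy0 : (0 : ℝ) < y := hy
  have e1 : |y ^ 2 - 1| ^ (-a) = |y - 1| ^ (-a) * (1 + y) ^ (-a) := by
    rw [← Real.mul_rpow (abs_nonneg _) (by positivity)]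
    congr 1
    rw [show y ^ 2 - 1 = (y - 1) * (1 + y) by ring, abs_mul, abs_of_pos (by positivity : 0 < 1 + y)]
  have e2 : (1 + y) ^ (-a) ≤ 1 :=
    Real.rpow_le_one_of_one_le_of_nonpos (by linarith) (by linarith)
  have e3 : (1 + y) ^ (n + 1) = (1 + y) ^ (n - 1) * (1 + y) ^ 2 := by
    rw [← pow_add]; congr 1; omega
  have e4 : (1 + y) ^ (-2 : ℝ) = ((1 + y) ^ 2)⁻¹ := by
    rw [Real.rpow_neg (by positivity)]; norm_cast
  rw [smul_eq_mul, Real.norm_of_nonneg (by positivity), e1, e3, e4, mul_inv]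
  have e5 : y ^ (n - 1) * ((1 + y) ^ (n - 1))⁻¹ ≤ 1 := by
    rw [← div_eq_mul_inv, div_le_one (by positivity)]
    gcongr
    linarith
  calc y ^ (n - 1) * (|y - 1| ^ (-a) * (1 + y) ^ (-a) *
        (((1 + y) ^ (n - 1))⁻¹ * ((1 + y) ^ 2)⁻¹))
      = (|y - 1| ^ (-a) * ((1 + y) ^ 2)⁻¹) *
        ((y ^ (n - 1) * ((1 + y) ^ (n - 1))⁻¹) * (1 + y) ^ (-a)) := by ring
    _ ≤ (|y - 1| ^ (-a) * ((1 + y) ^ 2)⁻¹) * (1 * 1) := by gcongr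
    _ = _ := by ring

/-- Gives one majorant for a whole interval of exponents, whether `t` is small or large. -/
theorem rpow_le_rpow_add_rpow {t : ℝ} (ht : 0 < t) {a b p : ℝ} (ha : a ≤ p) (hb : p ≤ b) :
    t ^ p ≤ t ^ a + t ^ b := by
  have h1 : 0 < t ^ a := by positivity
  have h2 : 0 < t ^ b := by positivity
  rcases le_total t 1 with h | h
  · linarith [Real.rpow_le_rpow_of_exponent_ge ht h ha]
  · linarith [Real.rpow_le_rpow_of_exponent_le h hb]

/-! ### The Bessel symbol: tempered bounds and holomorphy in the order -/

theorem besselSymbol_eq (s : ℂ) {ξ : EuclideanSpace ℝ (Fin n)} (hξ : ξ ≠ 0) :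
    besselSymbol n s ξ = (2 : ℂ) ^ s * (((‖ξ‖ ^ 2 / 4 : ℝ) : ℂ) ^ s *
      besselSeries s (‖ξ‖ ^ 2 / 4)) :=
  cpow_mul_besselJ_eq s (norm_pos_iff.2 hξ)

theorem ae_ne_zero (hn : 1 ≤ n) : ∀ᵐ ξ : EuclideanSpace ℝ (Fin n), ξ ≠ 0 := by
  have : Nontrivial (EuclideanSpace ℝ (Fin n)) := by
    have : Nonempty (Fin n) := ⟨⟨0, hn⟩⟩
    infer_instance
  exact compl_mem_ae_iff.2 (measure_singleton 0)

/-- Near the origin the symbol is `O(|ξ|^{2 Re s})`, integrable because `Re s > -n/2`; at infinity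
it grows polynomially. Uniformity over boxes in `s` serves both temperedness and holomorphy. -/
theorem exists_besselSymbol_bound (hn : 1 ≤ n) {a : ℝ} (ha : -((n : ℝ) / 2) < a) (b B : ℝ) :
    ∃ (N : ℕ) (W : EuclideanSpace ℝ (Fin n) → ℝ), Integrable W ∧
      ∀ s : ℂ, a ≤ s.re → s.re ≤ b → |s.im| ≤ B → ∀ ξ : EuclideanSpace ℝ (Fin n), ξ ≠ 0 →
        ((1 + ‖ξ‖) ^ N)⁻¹ * ‖besselSymbol n s ξ‖ ≤ W ξ := by
  obtain ⟨m, hm⟩ := exists_nat_gt (-a)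
  obtain ⟨C, hC0, hC⟩ := exists_norm_besselSeries_le m (a := a) (by linarith) b B
  obtain ⟨K, hK⟩ := exists_nat_gt (max (2 * a + n) (2 * b + n))
  have hKa := (le_max_left _ _).trans_lt hK
  have hKb := (le_max_right _ _).trans_lt hK
  -- If `b < a` no `s` qualifies; otherwise both exponents `2a` and `2b` exceed `-n`.
  rcases lt_or_ge b a with hab | hab
  · refine ⟨0, fun _ => 0, integrable_zero _ _ _, fun s h1 h2 => by linarith⟩
  refine ⟨2 * (m + 1) + K, fun ξ => C * (2 ^ (-a) * (‖ξ‖ ^ (2 * a) * ((1 + ‖ξ‖) ^ K)⁻¹) +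
    2 ^ (-b) * (‖ξ‖ ^ (2 * b) * ((1 + ‖ξ‖) ^ K)⁻¹)),
    (((integrable_norm_rpow_mul hn (by linarith) hKa).const_mul _).add
      ((integrable_norm_rpow_mul hn (by linarith) hKb).const_mul _)).const_mul _,
    fun s h1 h2 h3 ξ hξ => ?_⟩
  have hρ : 0 < ‖ξ‖ := norm_pos_iff.2 hξ
  set ρ := ‖ξ‖ with hρdef
  have hx : 0 < ρ ^ 2 / 4 := by positivity
  have hpow : ∀ c : ℝ, (ρ ^ 2 / 2) ^ c = 2 ^ (-c) * ρ ^ (2 * c) := by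
    intro c
    rw [Real.div_rpow (by positivity) (by norm_num), Real.rpow_neg (by norm_num),
      Real.rpow_mul hρ.le, Real.rpow_two, div_eq_inv_mul]
  have e1 : (2 : ℝ) ^ s.re * (ρ ^ 2 / 4) ^ s.re = (ρ ^ 2 / 2) ^ s.re := by
    rw [← Real.mul_rpow (by norm_num) hx.le]; congr 1; ring
  have e2 : ‖besselSymbol n s ξ‖ ≤ (2 ^ (-a) * ρ ^ (2 * a) + 2 ^ (-b) * ρ ^ (2 * b)) *
      (C * ((1 + ρ) ^ (2 * (m + 1)))) := by
    rw [besselSymbol_eq s hξ, norm_mul, norm_mul, Complex.norm_cpow_eq_rpow_re_of_pos hx,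
      ← mul_assoc]
    have e3 : ‖(2 : ℂ) ^ s‖ = 2 ^ s.re := by
      have := Complex.norm_cpow_eq_rpow_re_of_pos (x := 2) two_pos s
      simpa using this
    rw [e3, e1]
    have e4 : (ρ ^ 2 / 2) ^ s.re ≤ 2 ^ (-a) * ρ ^ (2 * a) + 2 ^ (-b) * ρ ^ (2 * b) := by
      rw [← hpow, ← hpow]
      exact rpow_le_rpow_add_rpow (by positivity) h1 h2
    have e5 : ‖besselSeries s (ρ ^ 2 / 4)‖ ≤ C * ((1 + ρ) ^ (2 * (m + 1))) := by
      refine (hC s h1 h2 h3 _ hx.le).trans ?_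
      rw [pow_mul]
      gcongr
      nlinarith
    gcongr
  calc _ ≤ ((1 + ρ) ^ (2 * (m + 1) + K))⁻¹ * ((2 ^ (-a) * ρ ^ (2 * a) + 2 ^ (-b) * ρ ^ (2 * b)) *
        (C * ((1 + ρ) ^ (2 * (m + 1))))) := by gcongr
    _ = _ := by
      rw [pow_add, mul_inv]
      have : (1 + ρ) ^ (2 * (m + 1)) ≠ 0 := by positivity
      simp only [← hρdef]
      field_simp

theorem aestronglyMeasurable_besselSymbol (hn : 1 ≤ n) (s : ℂ) :
    AEStronglyMeasurable (besselSymbol n s) := by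
  have h : Measurable fun ξ : EuclideanSpace ℝ (Fin n) => (2 : ℂ) ^ s *
      (((‖ξ‖ ^ 2 / 4 : ℝ) : ℂ) ^ s * besselSeries s (‖ξ‖ ^ 2 / 4)) := by
    have := (continuous_besselSeries s).measurable
    fun_prop
  refine h.aestronglyMeasurable.congr ?_
  filter_upwards [ae_ne_zero hn] with ξ hξ using (besselSymbol_eq s hξ).symm

theorem isTemperedIntegrable_besselSymbol (hn : 1 ≤ n) {s : ℂ} (hs : -((n : ℝ) / 2) < s.re) :
    IsTemperedIntegrable (besselSymbol n s) := by
  obtain ⟨N, W, hW, h⟩ := exists_besselSymbol_bound hn hs s.re |s.im|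
  refine ⟨N, hW.mono' ?_ ?_⟩
  · exact (by fun_prop : Measurable fun ξ : EuclideanSpace ℝ (Fin n) =>
      ((1 + ‖ξ‖) ^ N)⁻¹).aestronglyMeasurable.smul (aestronglyMeasurable_besselSymbol hn s)
  · filter_upwards [ae_ne_zero hn] with ξ hξ
    rw [norm_smul, norm_inv, norm_pow, Real.norm_of_nonneg (by positivity)]
    exact h s le_rfl le_rfl le_rfl ξ hξ

theorem isOpen_re_gt (a : ℝ) : IsOpen {s : ℂ | a < s.re} :=
  isOpen_lt continuous_const Complex.continuous_re

theorem abs_re_sub_le_of_mem_ball {s z : ℂ} {r : ℝ} (hz : z ∈ Metric.ball s r) :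
    s.re - r ≤ z.re ∧ z.re ≤ s.re + r ∧ |z.im| ≤ |s.im| + r := by
  have h : ‖z - s‖ < r := by simpa [dist_eq_norm] using hz
  have h1 := (Complex.abs_re_le_norm (z - s)).trans h.le
  have h2 := (Complex.abs_im_le_norm (z - s)).trans h.le
  rw [Complex.sub_re] at h1
  rw [Complex.sub_im] at h2
  have h3 := abs_le.1 h1
  refine ⟨by linarith, by linarith, ?_⟩
  linarith [abs_sub_abs_le_abs_sub z.im s.im]

theorem differentiableOn_integral_besselSymbol_mul (hn : 1 ≤ n)
    {h : EuclideanSpace ℝ (Fin n) → ℂ} (hh : Continuous h)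
    (hdecay : ∀ N : ℕ, ∃ C, ∀ ξ, (1 + ‖ξ‖) ^ N * ‖h ξ‖ ≤ C) :
    DifferentiableOn ℂ (fun s => ∫ ξ, besselSymbol n s ξ * h ξ) {s | -((n : ℝ) / 2) < s.re} := by
  refine differentiableOn_integral_of_locally_dominated (isOpen_re_gt _)
    (fun s _ => (aestronglyMeasurable_besselSymbol hn s).mul hh.aestronglyMeasurable) ?_
    fun s hs => ?_
  · filter_upwards [ae_ne_zero hn] with ξ hξ
    have hx : ((‖ξ‖ ^ 2 / 4 : ℝ) : ℂ) ≠ 0 := by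
      have : 0 < ‖ξ‖ := norm_pos_iff.2 hξ
      exact_mod_cast (by positivity : ‖ξ‖ ^ 2 / 4 ≠ 0)
    simp only [besselSymbol_eq _ hξ]
    refine Differentiable.differentiableOn ?_
    have := differentiable_besselSeries (‖ξ‖ ^ 2 / 4)
    refine Differentiable.mul_const (Differentiable.mul ?_ (Differentiable.mul ?_ this)) _
    · exact differentiable_id.const_cpow (Or.inl two_ne_zero)
    · exact differentiable_id.const_cpow (Or.inl hx)
  -- Half the distance from `s` to the boundary line `Re s = -n/2`.
  · have hr : 0 < (s.re + n / 2) / 2 := by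
      have : -((n : ℝ) / 2) < s.re := hs
      linarith
    obtain ⟨N, W, hW, hb⟩ := exists_besselSymbol_bound hn
      (a := s.re - (s.re + n / 2) / 2) (by linarith) (s.re + (s.re + n / 2) / 2)
      (|s.im| + (s.re + n / 2) / 2)
    obtain ⟨C, hC⟩ := hdecay N
    refine ⟨_, Metric.ball_mem_nhds s hr, _, hW.mul_const C, ?_⟩
    filter_upwards [ae_ne_zero hn] with ξ hξ z hz
    obtain ⟨h1, h2, h3⟩ := abs_re_sub_le_of_mem_ball hz
    have hW0 : 0 ≤ W ξ := le_trans (by positivity) (hb z h1 h2 h3 ξ hξ)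
    have hp : (1 + ‖ξ‖) ^ N ≠ 0 := by positivity
    calc ‖besselSymbol n z ξ * h ξ‖
        = (((1 + ‖ξ‖) ^ N)⁻¹ * ‖besselSymbol n z ξ‖) * ((1 + ‖ξ‖) ^ N * ‖h ξ‖) := by
          rw [norm_mul]; field_simp
      _ ≤ W ξ * C := by
          gcongr
          · exact hb z h1 h2 h3 ξ hξ
          · exact hC ξ

/-! ### The explicit function: bounds, integrability and holomorphy -/

/-- The constant `2^s Γ(n/2+s) / π^(n/2+1)`. -/
def besselTransformConst (n : ℕ) (s : ℂ) : ℂ :=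
  (2 : ℂ) ^ s * Complex.Gamma ((n : ℂ) / 2 + s) / (Real.pi : ℂ) ^ ((n : ℂ) / 2 + 1)

theorem differentiableOn_besselTransformConst (n : ℕ) :
    DifferentiableOn ℂ (besselTransformConst n) {s | -((n : ℝ) / 2) < s.re} := by
  intro s hs
  have hre : 0 < ((n : ℂ) / 2 + s).re := by
    have h1 : -((n : ℝ) / 2) < s.re := hs
    have h2 : ((n : ℂ) / 2 + s).re = (n : ℝ) / 2 + s.re := by simp
    linarith
  have hG : DifferentiableAt ℂ (fun s : ℂ => Complex.Gamma ((n : ℂ) / 2 + s)) s := by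
    refine (Complex.differentiableAt_Gamma _ fun m hm => ?_).comp s (by fun_prop)
    rw [hm] at hre
    simp at hre
    linarith [(Nat.cast_nonneg m : (0 : ℝ) ≤ m)]
  have h2 : DifferentiableAt ℂ (fun s : ℂ => (2 : ℂ) ^ s) s :=
    differentiableAt_id.const_cpow (Or.inl two_ne_zero)
  exact ((h2.mul hG).div_const _).differentiableWithinAt

theorem exists_norm_besselTransform_le (n : ℕ) {K : Set ℂ} (hK : IsCompact K)
    (hKs : K ⊆ {s | -((n : ℝ) / 2) < s.re}) :
    ∃ M : ℝ, 0 ≤ M ∧ ∀ s ∈ K, ∀ x : EuclideanSpace ℝ (Fin n),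
      ‖besselTransform n s x‖ ≤ M * |‖x‖ ^ 2 - 1| ^ (-((n : ℝ) / 2 + s.re)) := by
  have hc := (differentiableOn_besselTransformConst n).continuousOn.mono hKs
  obtain ⟨M1, hM1⟩ := hK.exists_bound_of_continuousOn (f := fun s =>
    Complex.sin ((n : ℂ) * Real.pi / 2) * besselTransformConst n s) (by fun_prop)
  obtain ⟨M2, hM2⟩ := hK.exists_bound_of_continuousOn (f := fun s =>
    -Complex.sin (s * Real.pi) * besselTransformConst n s) (by fun_prop)
  refine ⟨max (max M1 M2) 0, le_max_right _ _, fun s hs x => ?_⟩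
  have hre : (-((n : ℂ) / 2) - s).re = -((n : ℝ) / 2 + s.re) := by simp; ring
  unfold besselTransform
  split_ifs with h1 h2
  · have hp : 0 < 1 - ‖x‖ ^ 2 := by nlinarith [norm_nonneg x]
    rw [norm_mul, Complex.norm_cpow_eq_rpow_re_of_pos hp, hre, abs_sub_comm, abs_of_pos hp]
    gcongr
    exact (hM1 s hs).trans ((le_max_left _ _).trans (le_max_left _ _))
  · have hp : 0 < ‖x‖ ^ 2 - 1 := by nlinarith [norm_nonneg x]
    rw [norm_mul, Complex.norm_cpow_eq_rpow_re_of_pos hp, hre, abs_of_pos hp]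
    gcongr
    exact (hM2 s hs).trans ((le_max_right _ _).trans (le_max_left _ _))
  · rw [norm_zero]; positivity

theorem measurable_besselTransform (n : ℕ) (s : ℂ) : Measurable (besselTransform n s) := by
  unfold besselTransform
  refine Measurable.ite (measurableSet_lt (by fun_prop) (by fun_prop)) (by fun_prop)
    (Measurable.ite (measurableSet_lt (by fun_prop) (by fun_prop)) (by fun_prop) (by fun_prop))

theorem differentiableOn_besselTransform (n : ℕ) (x : EuclideanSpace ℝ (Fin n)) :
    DifferentiableOn ℂ (fun s => besselTransform n s x) {s | -((n : ℝ) / 2) < s.re} := by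
  have hpow : ∀ c : ℝ, c ≠ 0 → Differentiable ℂ fun s : ℂ => (c : ℂ) ^ (-((n : ℂ) / 2) - s) :=
    fun c hc => Differentiable.const_cpow (by fun_prop) (Or.inl (by exact_mod_cast hc))
  have hc := differentiableOn_besselTransformConst n
  unfold besselTransform
  split_ifs with h1 h2
  · have hp : 1 - ‖x‖ ^ 2 ≠ 0 := by nlinarith [norm_nonneg x]
    exact (hc.const_mul _).mul (hpow _ hp).differentiableOn
  · have hp : ‖x‖ ^ 2 - 1 ≠ 0 := by nlinarith [norm_nonneg x]
    have hsin : Differentiable ℂ fun s : ℂ => -Complex.sin (s * Real.pi) := by fun_prop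
    exact (hsin.differentiableOn.mul hc).mul (hpow _ hp).differentiableOn
  · exact differentiableOn_const _

theorem integrable_besselTransform_mul {s : ℂ} (hs : -((n : ℝ) / 2) < s.re)
    {φ : EuclideanSpace ℝ (Fin n) → ℂ} (hφ : Continuous φ)
    (hi : Integrable fun x => |‖x‖ ^ 2 - 1| ^ (-((n : ℝ) / 2 + s.re)) * ‖φ x‖) :
    Integrable fun x => besselTransform n s x * φ x := by
  obtain ⟨M, hM0, hM⟩ := exists_norm_besselTransform_le n (isCompact_singleton (x := s))
    (by simpa using hs)
  refine (hi.const_mul M).mono'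
    ((measurable_besselTransform n s).aestronglyMeasurable.mul hφ.aestronglyMeasurable)
    (Eventually.of_forall fun x => ?_)
  rw [norm_mul, ← mul_assoc]
  gcongr
  exact hM s rfl x

theorem ae_abs_norm_sq_sub_one_pos (hn : 1 ≤ n) :
    ∀ᵐ x : EuclideanSpace ℝ (Fin n), 0 < |‖x‖ ^ 2 - 1| := by
  have : Nontrivial (EuclideanSpace ℝ (Fin n)) := by
    have : Nonempty (Fin n) := ⟨⟨0, hn⟩⟩
    infer_instance
  have h := Measure.addHaar_sphere volume (0 : EuclideanSpace ℝ (Fin n)) 1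
  filter_upwards [compl_mem_ae_iff.2 h] with x hx
  rw [abs_pos, sub_ne_zero]
  intro h1
  refine hx ?_
  rw [mem_sphere_zero_iff_norm]
  nlinarith [norm_nonneg x]

theorem differentiableOn_integral_besselTransform_mul (hn : 1 ≤ n) {U : Set ℂ} (hU : IsOpen U)
    (hUs : U ⊆ {s | -((n : ℝ) / 2) < s.re}) {φ : EuclideanSpace ℝ (Fin n) → ℂ}
    (hφ : Continuous φ)
    (hi : ∀ s ∈ U, Integrable fun x => |‖x‖ ^ 2 - 1| ^ (-((n : ℝ) / 2 + s.re)) * ‖φ x‖) :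
    DifferentiableOn ℂ (fun s => ∫ x, besselTransform n s x * φ x) U := by
  refine differentiableOn_integral_of_locally_dominated hU
    (fun s _ => (measurable_besselTransform n s).aestronglyMeasurable.mul hφ.aestronglyMeasurable)
    (Eventually.of_forall fun x =>
      ((differentiableOn_besselTransform n x).mono hUs).mul_const _) fun s hs => ?_
  obtain ⟨R, hR, hRU⟩ := Metric.mem_nhds_iff.1 (hU.mem_nhds hs)
  have hR2 : 0 < R / 2 := by positivity
  have hsub : Metric.closedBall s (R / 2) ⊆ U :=
    (Metric.closedBall_subset_ball (by linarith)).trans hRU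
  obtain ⟨M, hM0, hM⟩ := exists_norm_besselTransform_le n (isCompact_closedBall s (R / 2))
    (hsub.trans hUs)
  have hm : ∀ t : ℝ, |t| ≤ R / 2 → s + t ∈ U := by
    intro t ht
    refine hsub ?_
    rw [Metric.mem_closedBall, dist_eq_norm, add_sub_cancel_left, Complex.norm_real]
    exact ht
  -- Integrability at the two parameters `s ± R/2` dominates every parameter in the ball between
  -- them.
  have i1 := hi _ (hm (R / 2) (by rw [abs_of_pos hR2]))
  have i2 := hi _ (hm (-(R / 2)) (by rw [abs_neg, abs_of_pos hR2]))
  refine ⟨_, Metric.ball_mem_nhds s hR2, _, (i1.add i2).const_mul M, ?_⟩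
  filter_upwards [ae_abs_norm_sq_sub_one_pos hn] with x hx z hz
  obtain ⟨h1, h2, -⟩ := abs_re_sub_le_of_mem_ball hz
  have h3 := hM z (Metric.ball_subset_closedBall hz) x
  have h4 := rpow_le_rpow_add_rpow hx (a := -((n : ℝ) / 2 + (s + ((R / 2 : ℝ) : ℂ)).re))
    (b := -((n : ℝ) / 2 + (s + ((-(R / 2) : ℝ) : ℂ)).re)) (p := -((n : ℝ) / 2 + z.re))
    (by rw [Complex.add_re, Complex.ofReal_re]; linarith)
    (by rw [Complex.add_re, Complex.ofReal_re]; linarith)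
  rw [norm_mul]
  calc _ ≤ M * |‖x‖ ^ 2 - 1| ^ (-((n : ℝ) / 2 + z.re)) * ‖φ x‖ := by gcongr
    _ ≤ M * (|‖x‖ ^ 2 - 1| ^ (-((n : ℝ) / 2 + (s + ((R / 2 : ℝ) : ℂ)).re)) +
        |‖x‖ ^ 2 - 1| ^ (-((n : ℝ) / 2 + (s + ((-(R / 2) : ℝ) : ℂ)).re))) * ‖φ x‖ := by gcongr
    _ = _ := by rw [Pi.add_apply]; ring

theorem integrable_rpow_mul_schwartz (hn : 1 ≤ n) {a : ℝ} (ha0 : 0 ≤ a) (ha : a < 1)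
    (φ : 𝓢(EuclideanSpace ℝ (Fin n), ℂ)) :
    Integrable fun x => |‖x‖ ^ 2 - 1| ^ (-a) * ‖φ x‖ := by
  refine ((integrable_abs_norm_sq_sub_one_rpow_mul hn ha0 ha).mul_const
    (2 ^ (n + 1) * (Finset.Iic (n + 1, 0)).sup (schwartzSeminormFamily ℂ _ ℂ) φ)).mono' ?_
    (Eventually.of_forall fun x => ?_)
  · exact (by fun_prop : Measurable fun x : EuclideanSpace ℝ (Fin n) =>
      |‖x‖ ^ 2 - 1| ^ (-a)).aestronglyMeasurable.mul φ.continuous.norm.aestronglyMeasurable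
  · rw [Real.norm_of_nonneg (by positivity)]
    have hp : (1 + ‖x‖) ^ (n + 1) ≠ 0 := by positivity
    calc |‖x‖ ^ 2 - 1| ^ (-a) * ‖φ x‖
        = |‖x‖ ^ 2 - 1| ^ (-a) * ((1 + ‖x‖) ^ (n + 1))⁻¹ * ((1 + ‖x‖) ^ (n + 1) * ‖φ x‖) := by
          field_simp
      _ ≤ _ := mul_le_mul_of_nonneg_left (schwartz_decay φ (n + 1) x) (by positivity)

/-- The compact sphere has positive distance `δ` from the closed support, so the weight is bounded
there, whatever `a ≥ 0` is. -/
theorem integrable_rpow_mul_schwartz_of_disjoint {a : ℝ} (ha0 : 0 ≤ a)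
    (φ : 𝓢(EuclideanSpace ℝ (Fin n), ℂ))
    (hd : Disjoint (tsupport φ) (Metric.sphere (0 : EuclideanSpace ℝ (Fin n)) 1)) :
    Integrable fun x => |‖x‖ ^ 2 - 1| ^ (-a) * ‖φ x‖ := by
  obtain ⟨δ, hδ, hdisj⟩ := hd.symm.exists_thickenings (isCompact_sphere _ _) (isClosed_tsupport φ)
  have hlow : ∀ x, φ x ≠ 0 → min δ 1 ≤ |‖x‖ ^ 2 - 1| := by
    intro x hx
    have hxs : x ∈ Metric.thickening δ (tsupport φ) :=
      Metric.self_subset_thickening hδ _ (subset_tsupport _ hx)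
    have hxn : x ∉ Metric.thickening δ (Metric.sphere (0 : EuclideanSpace ℝ (Fin n)) 1) :=
      fun h => Set.disjoint_left.1 hdisj h hxs
    rcases eq_or_ne x 0 with rfl | hx0
    · simp
    have hx0' : 0 < ‖x‖ := norm_pos_iff.2 hx0
    have hδx : δ ≤ |‖x‖ - 1| := by
      -- The point `x/|x|` of the sphere lies at distance `||x| - 1|` from `x`.
      by_contra! hlt
      refine hxn (Metric.mem_thickening_iff.2 ⟨‖x‖⁻¹ • x, ?_, ?_⟩)
      · rw [mem_sphere_zero_iff_norm, norm_smul, norm_inv, norm_norm, inv_mul_cancel₀ hx0'.ne']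
      · rw [dist_eq_norm]
        have : x - ‖x‖⁻¹ • x = (1 - ‖x‖⁻¹) • x := by rw [sub_smul, one_smul]
        rw [this, norm_smul, Real.norm_eq_abs, ← abs_norm x, ← abs_mul, abs_norm, sub_mul, one_mul,
          inv_mul_cancel₀ hx0'.ne']
        exact hlt
    rw [show ‖x‖ ^ 2 - 1 = (‖x‖ - 1) * (‖x‖ + 1) by ring, abs_mul,
      abs_of_pos (by positivity : 0 < ‖x‖ + 1)]
    refine (min_le_left _ _).trans ?_
    nlinarith [abs_nonneg (‖x‖ - 1)]
  refine (φ.integrable.norm.const_mul ((min δ 1) ^ (-a))).mono' ?_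
    (Eventually.of_forall fun x => ?_)
  · exact (by fun_prop : Measurable fun x : EuclideanSpace ℝ (Fin n) =>
      |‖x‖ ^ 2 - 1| ^ (-a)).aestronglyMeasurable.mul φ.continuous.norm.aestronglyMeasurable
  · rw [Real.norm_of_nonneg (by positivity)]
    rcases eq_or_ne (φ x) 0 with h0 | h0
    · simp [h0]
    · gcongr ?_ * _
      exact Real.rpow_le_rpow_of_nonpos (by positivity) (hlow x h0) (by linarith)

end

/-! ### Gaussian pairings and the contour formula for the pairing -/

theorem Complex.ofReal_mul_cpow {r : ℝ} (hr : 0 < r) {z : ℂ} (hz : z ≠ 0) (s : ℂ) :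
    ((r : ℂ) * z) ^ s = (r : ℂ) ^ s * z ^ s := by
  have hr' : (r : ℂ) ≠ 0 := Complex.ofReal_ne_zero.2 hr.ne'
  rw [Complex.cpow_def_of_ne_zero (mul_ne_zero hr' hz), Complex.cpow_def_of_ne_zero hr',
    Complex.cpow_def_of_ne_zero hz, ← Complex.exp_add, Complex.log_ofReal_mul hr hz,
    Complex.ofReal_log hr.le]
  congr 1
  ring

section

variable {n : ℕ}

/-- The pairing of the inverse Fourier transform of `φ` with the Gaussian
`exp (-(δ - iy) |ξ|² / 4)`. -/
def gaussPairing (φ : 𝓢(EuclideanSpace ℝ (Fin n), ℂ)) (δ y : ℝ) : ℂ :=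
  ∫ ξ, Complex.exp (-(((δ : ℂ) - y * Complex.I) / 4) * (‖ξ‖ : ℂ) ^ 2) * invFourierCLM n φ ξ

/-- The constant `(2π)^(-n) (4π)^(n/2)`. -/
def gaussConst (n : ℕ) : ℂ := ((2 * Real.pi : ℝ) : ℂ)⁻¹ ^ n * ((4 * Real.pi : ℝ) : ℂ) ^ ((n : ℂ) / 2)

theorem norm_cexp_vertical_le_one {δ : ℝ} (hδ : 0 ≤ δ) (y : ℝ) (ξ : EuclideanSpace ℝ (Fin n)) :
    ‖Complex.exp (-(((δ : ℂ) - y * Complex.I) / 4) * (‖ξ‖ : ℂ) ^ 2)‖ ≤ 1 := by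
  rw [Complex.norm_exp, Real.exp_le_one_iff]
  have : (-(((δ : ℂ) - y * Complex.I) / 4) * (‖ξ‖ : ℂ) ^ 2).re = -(δ / 4 * ‖ξ‖ ^ 2) := by
    rw [← Complex.ofReal_pow, Complex.re_mul_ofReal]
    simp
  rw [this, neg_nonpos]
  positivity

theorem norm_gaussPairing_le (φ : 𝓢(EuclideanSpace ℝ (Fin n), ℂ)) {δ : ℝ} (hδ : 0 ≤ δ) (y : ℝ) :
    ‖gaussPairing φ δ y‖ ≤ ∫ ξ, ‖invFourierCLM n φ ξ‖ := by
  refine norm_integral_le_of_norm_le (invFourierCLM n φ).integrable.norm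
    (Eventually.of_forall fun ξ => ?_)
  rw [norm_mul]
  exact mul_le_of_le_one_left (norm_nonneg _) (norm_cexp_vertical_le_one hδ y ξ)

theorem continuousOn_gaussPairing (φ : 𝓢(EuclideanSpace ℝ (Fin n), ℂ)) :
    ContinuousOn (fun p : ℝ × ℝ => gaussPairing φ p.1 p.2) {p | 0 ≤ p.1} := by
  have hψ := (invFourierCLM n φ).continuous
  refine continuousOn_of_dominated (bound := fun ξ => ‖invFourierCLM n φ ξ‖)
    (fun p _ => Continuous.aestronglyMeasurable (by fun_prop)) (fun p hp => ?_)
    (invFourierCLM n φ).integrable.norm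
    (Eventually.of_forall fun ξ => Continuous.continuousOn (by fun_prop))
  refine Eventually.of_forall fun ξ => ?_
  rw [norm_mul]
  exact mul_le_of_le_one_left (norm_nonneg _) (norm_cexp_vertical_le_one hp p.2 ξ)

theorem continuous_gaussPairing (φ : 𝓢(EuclideanSpace ℝ (Fin n), ℂ)) {δ : ℝ} (hδ : 0 ≤ δ) :
    Continuous (gaussPairing φ δ) :=
  (continuousOn_gaussPairing φ).comp_continuous (f := fun y : ℝ => (δ, y)) (by fun_prop)
    fun _ => hδ

theorem norm_cexp_neg_sq_mul_inv_le_one {w : ℂ} (hw : 0 ≤ w.re) (x : EuclideanSpace ℝ (Fin n)) :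
    ‖Complex.exp (-(‖x‖ : ℂ) ^ 2 * w⁻¹)‖ ≤ 1 := by
  rw [Complex.norm_exp, Real.exp_le_one_iff, ← Complex.ofReal_pow, ← Complex.ofReal_neg,
    Complex.re_ofReal_mul, Complex.inv_re]
  have h1 := div_nonneg hw (Complex.normSq_nonneg w)
  nlinarith [sq_nonneg ‖x‖]

theorem gaussPairing_eq_of_pos (φ : 𝓢(EuclideanSpace ℝ (Fin n), ℂ)) {δ : ℝ} (hδ : 0 < δ) (y : ℝ) :
    gaussPairing φ δ y = gaussConst n * ((δ : ℂ) - y * Complex.I)⁻¹ ^ ((n : ℂ) / 2) *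
      ∫ x, Complex.exp (-(‖x‖ : ℂ) ^ 2 * ((δ : ℂ) - y * Complex.I)⁻¹) * φ x := by
  set w : ℂ := (δ : ℂ) - y * Complex.I with hw
  have hwre : w.re = δ := by simp [hw]
  have hw0 : w ≠ 0 := fun h => by rw [h] at hwre; simp at hwre; linarith
  have hb : 0 < (w / 4).re := by
    rw [show w / 4 = w / ((4 : ℝ) : ℂ) by norm_num, Complex.div_ofReal_re, hwre]; positivity
  have h := integral_gaussian_mul_invFourierIntegral hb φ.integrable
  simp only [← invFourierCLM_apply] at h
  rw [gaussPairing, h, gaussConst, show (Real.pi : ℂ) / (w / 4) = ((4 * Real.pi : ℝ) : ℂ) * w⁻¹ by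
    push_cast; field_simp, Complex.ofReal_mul_cpow (by positivity) (inv_ne_zero hw0), ← mul_assoc]
  congr 2 with x
  rw [show 4 * (w / 4) = w by ring, div_eq_mul_inv]

theorem vertical_conj_inv_mem_slitPlane {δ y : ℝ} (hδ : 0 ≤ δ) (h : 0 < δ ∨ y ≠ 0) :
    ((δ : ℂ) - y * Complex.I)⁻¹ ∈ Complex.slitPlane := by
  have hre : ((δ : ℂ) - y * Complex.I).re = δ := by simp
  have him : ((δ : ℂ) - y * Complex.I).im = -y := by simp
  have hN : 0 < Complex.normSq ((δ : ℂ) - y * Complex.I) := by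
    rw [Complex.normSq_pos]
    intro h0
    rw [h0] at hre him
    simp only [Complex.zero_re, Complex.zero_im] at hre him
    rcases h with h | h
    · exact h.ne hre
    · exact h (by linarith)
  rw [Complex.mem_slitPlane_iff, Complex.inv_re, Complex.inv_im, hre, him, neg_neg]
  exact h.imp (fun h => by positivity) (fun h => div_ne_zero h hN.ne')

/-- On the imaginary axis the Gaussian is no longer integrable, so the formula is reached as a limit
`δ → 0+`. The power is continuous because `(δ-iy)⁻¹` stays in the slit plane, and `|φ|` dominates
the integral. -/
theorem gaussPairing_zero_eq (φ : 𝓢(EuclideanSpace ℝ (Fin n), ℂ)) {y : ℝ} (hy : y ≠ 0) :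
    gaussPairing φ 0 y = gaussConst n * (((0 : ℝ) : ℂ) - y * Complex.I)⁻¹ ^ ((n : ℂ) / 2) *
      ∫ x, Complex.exp (-(‖x‖ : ℂ) ^ 2 * (((0 : ℝ) : ℂ) - y * Complex.I)⁻¹) * φ x := by
  have h0 : (((0 : ℝ) : ℂ) - y * Complex.I) ≠ 0 := by simpa using hy
  have hinv : ContinuousAt (fun δ : ℝ => ((δ : ℂ) - y * Complex.I)⁻¹) 0 :=
    ContinuousAt.inv₀ (by fun_prop) h0
  have hL : Tendsto (fun δ : ℝ => gaussPairing φ δ y) (𝓝[>] 0) (𝓝 (gaussPairing φ 0 y)) := by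
    have h1 : ContinuousOn (fun δ : ℝ => gaussPairing φ δ y) (Set.Ici 0) :=
      (continuousOn_gaussPairing φ).comp (f := fun δ : ℝ => (δ, y)) (by fun_prop) fun δ hδ => hδ
    exact (h1 0 Set.self_mem_Ici).mono_left (nhdsWithin_mono _ Set.Ioi_subset_Ici_self)
  refine tendsto_nhds_unique hL (Tendsto.congr' (f₁ := fun δ : ℝ => gaussConst n *
    ((δ : ℂ) - y * Complex.I)⁻¹ ^ ((n : ℂ) / 2) *
      ∫ x, Complex.exp (-(‖x‖ : ℂ) ^ 2 * ((δ : ℂ) - y * Complex.I)⁻¹) * φ x) ?_ ?_)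
  · filter_upwards [self_mem_nhdsWithin] with δ hδ using (gaussPairing_eq_of_pos φ hδ y).symm
  · refine Tendsto.mul (Tendsto.const_mul _ ?_) ?_
    · exact (hinv.cpow continuousAt_const
        (vertical_conj_inv_mem_slitPlane le_rfl (Or.inr hy))).tendsto.mono_left nhdsWithin_le_nhds
    · refine tendsto_integral_filter_of_dominated_convergence (fun x => ‖φ x‖)
        (Eventually.of_forall fun δ => ?_) ?_ φ.integrable.norm (Eventually.of_forall fun x => ?_)
      · have := φ.continuous
        exact Continuous.aestronglyMeasurable (by fun_prop)
      · filter_upwards [self_mem_nhdsWithin] with δ hδ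
        refine Eventually.of_forall fun x => ?_
        rw [norm_mul]
        refine mul_le_of_le_one_left (norm_nonneg _) (norm_cexp_neg_sq_mul_inv_le_one ?_ x)
        simpa using (show (0 : ℝ) < δ from hδ).le
      · have h2 : ContinuousAt (fun δ : ℝ =>
            Complex.exp (-(‖x‖ : ℂ) ^ 2 * ((δ : ℂ) - y * Complex.I)⁻¹) * φ x) 0 :=
          ((continuousAt_const.mul hinv).cexp).mul continuousAt_const
        exact h2.tendsto.mono_left nhdsWithin_le_nhds

/-- Dispersive decay: the Gaussian transform contributes `|w|^{-n/2}` with `w = δ - iy`, and its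
exponential has modulus at most `1`. This improves the range of the contour integral from `Re s > 0`
to `Re s > -n/2`. -/
theorem exists_norm_gaussPairing_le (φ : 𝓢(EuclideanSpace ℝ (Fin n), ℂ)) :
    ∃ D : ℝ, 0 ≤ D ∧ ∀ δ : ℝ, 0 < δ → ∀ y : ℝ,
      ‖gaussPairing φ δ y‖ ≤ D * ‖(δ : ℂ) + y * Complex.I‖ ^ (-((n : ℝ) / 2)) := by
  refine ⟨‖gaussConst n‖ * ∫ x, ‖φ x‖, by positivity, fun δ hδ y => ?_⟩
  have hn : ‖(δ : ℂ) - y * Complex.I‖ = ‖(δ : ℂ) + y * Complex.I‖ := by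
    rw [← Complex.norm_conj]; simp
  rw [gaussPairing_eq_of_pos φ hδ y, norm_mul, norm_mul, mul_right_comm]
  gcongr
  · refine norm_integral_le_of_norm_le φ.integrable.norm (Eventually.of_forall fun x => ?_)
    rw [norm_mul]
    exact mul_le_of_le_one_left (norm_nonneg _)
      (norm_cexp_neg_sq_mul_inv_le_one (by simpa using hδ.le) x)
  · refine (Complex.norm_cpow_le_rpow_mul_exp _ _).trans_eq ?_
    have h1 : ((n : ℂ) / 2).re = (n : ℝ) / 2 := by simp
    have h2 : ((n : ℂ) / 2).im = 0 := by simp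
    rw [h1, h2, norm_inv, hn, Real.inv_rpow (norm_nonneg _), Real.rpow_neg (norm_nonneg _)]
    simp

theorem norm_vertical_integrand_le (φ : 𝓢(EuclideanSpace ℝ (Fin n), ℂ)) (s : ℂ) {δ : ℝ}
    (hδ : 0 < δ) (y : ℝ) :
    ‖((δ : ℂ) + y * Complex.I) ^ (-(s + 1)) * Complex.exp (-((δ : ℂ) + y * Complex.I)⁻¹) *
      gaussPairing φ δ y‖ ≤
      Real.exp (Real.pi * |s.im|) * (‖(δ : ℂ) + y * Complex.I‖ ^ (-(s.re + 1)) *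
        ‖gaussPairing φ δ y‖) := by
  have h1 := Complex.norm_cpow_le_rpow_mul_exp ((δ : ℂ) + y * Complex.I) (-(s + 1))
  have h2 : (-(s + 1)).re = -(s.re + 1) := by simp
  have h3 : |(-(s + 1)).im| = |s.im| := by simp
  rw [h2, h3] at h1
  have h4 := norm_cexp_neg_inv_le_one (v := (δ : ℂ) + y * Complex.I) (by simpa using hδ.le)
  rw [norm_mul, norm_mul]
  calc _ ≤ ‖(δ : ℂ) + y * Complex.I‖ ^ (-(s.re + 1)) * Real.exp (Real.pi * |s.im|) * 1 *
        ‖gaussPairing φ δ y‖ := by gcongr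
    _ = _ := by ring

theorem continuous_vertical_integrand (φ : 𝓢(EuclideanSpace ℝ (Fin n), ℂ)) (s : ℂ) {δ : ℝ}
    (hδ : 0 < δ) : Continuous fun y : ℝ =>
      ((δ : ℂ) + y * Complex.I) ^ (-(s + 1)) * Complex.exp (-((δ : ℂ) + y * Complex.I)⁻¹) *
        gaussPairing φ δ y := by
  have h1 := continuous_vertical_cpow hδ (-(s + 1))
  have h2 := continuous_gaussPairing φ hδ.le
  have h3 : Continuous fun y : ℝ => ((δ : ℂ) + y * Complex.I)⁻¹ :=
    Continuous.inv₀ (by fun_prop) fun y => Complex.slitPlane_ne_zero (vertical_mem_slitPlane hδ y)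
  fun_prop

theorem exists_integrable_vertical_bound (φ : 𝓢(EuclideanSpace ℝ (Fin n), ℂ)) {δ : ℝ} (hδ : 0 < δ)
    (hδ1 : δ ≤ 1) {a : ℝ} (ha : -((n : ℝ) / 2) < a) (b B : ℝ) :
    ∃ W : ℝ → ℝ, Integrable W ∧ ∀ s : ℂ, a ≤ s.re → s.re ≤ b → |s.im| ≤ B → ∀ y : ℝ,
      ‖((δ : ℂ) + y * Complex.I) ^ (-(s + 1)) * Complex.exp (-((δ : ℂ) + y * Complex.I)⁻¹) *
        gaussPairing φ δ y‖ ≤ W y := by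
  obtain ⟨D, hD0, hD⟩ := exists_norm_gaussPairing_le φ
  refine ⟨fun y => Real.exp (Real.pi * B) * (D * ((δ / 2) ^ (-(b + 1 + n / 2)) *
    (1 + |y|) ^ (-(a + 1 + n / 2)))),
    (((integrable_one_add_abs_rpow_neg (by linarith)).const_mul _).const_mul _).const_mul _,
    fun s h1 h2 h3 y => ?_⟩
  refine (norm_vertical_integrand_le φ s hδ y).trans ?_
  dsimp only
  gcongr ?_ * ?_
  · gcongr
  have hv : 0 < ‖(δ : ℂ) + y * Complex.I‖ :=
    norm_pos_iff.2 (Complex.slitPlane_ne_zero (vertical_mem_slitPlane hδ y))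
  calc _ ≤ ‖(δ : ℂ) + y * Complex.I‖ ^ (-(s.re + 1)) *
        (D * ‖(δ : ℂ) + y * Complex.I‖ ^ (-((n : ℝ) / 2))) := by gcongr; exact hD δ hδ y
    _ = D * ‖(δ : ℂ) + y * Complex.I‖ ^ (-(s.re + 1 + n / 2)) := by
      rw [mul_left_comm, ← Real.rpow_add hv]; congr 2; ring
    _ ≤ D * ((δ / 2) ^ (-(s.re + 1 + n / 2)) * (1 + |y|) ^ (-(s.re + 1 + n / 2))) := by
      gcongr
      exact norm_vertical_rpow_neg_le hδ hδ1 (by linarith) y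
    _ ≤ _ := by
      -- The base `δ/2` is below `1`, so the extreme exponent is at `b`; the base `1 + |y|` is at
      -- least `1`, so there it is at `a`.
      gcongr ?_ * (?_ * ?_)
      · exact Real.rpow_le_rpow_of_exponent_ge (by positivity) (by linarith) (by linarith)
      · exact Real.rpow_le_rpow_of_exponent_le (by simp) (by linarith)

theorem integrable_vertical_integrand (φ : 𝓢(EuclideanSpace ℝ (Fin n), ℂ)) {s : ℂ}
    (hs : -((n : ℝ) / 2) < s.re) {δ : ℝ} (hδ : 0 < δ) (hδ1 : δ ≤ 1) : Integrable fun y : ℝ =>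
      ((δ : ℂ) + y * Complex.I) ^ (-(s + 1)) * Complex.exp (-((δ : ℂ) + y * Complex.I)⁻¹) *
        gaussPairing φ δ y := by
  obtain ⟨W, hW, h⟩ := exists_integrable_vertical_bound φ hδ hδ1 hs s.re |s.im|
  exact hW.mono' (continuous_vertical_integrand φ s hδ).aestronglyMeasurable
    (Eventually.of_forall fun y => h s le_rfl le_rfl le_rfl y)

theorem differentiableOn_integral_vertical (φ : 𝓢(EuclideanSpace ℝ (Fin n), ℂ)) {δ : ℝ}
    (hδ : 0 < δ) (hδ1 : δ ≤ 1) : DifferentiableOn ℂ (fun s : ℂ => ∫ y : ℝ,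
      ((δ : ℂ) + y * Complex.I) ^ (-(s + 1)) * Complex.exp (-((δ : ℂ) + y * Complex.I)⁻¹) *
        gaussPairing φ δ y) {s | -((n : ℝ) / 2) < s.re} := by
  refine differentiableOn_integral_of_locally_dominated (isOpen_re_gt _)
    (fun s _ => (continuous_vertical_integrand φ s hδ).aestronglyMeasurable)
    (Eventually.of_forall fun y => ?_) fun s hs => ?_
  · have hv := Complex.slitPlane_ne_zero (vertical_mem_slitPlane hδ y)
    have : Differentiable ℂ fun s : ℂ => ((δ : ℂ) + y * Complex.I) ^ (-(s + 1)) :=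
      Differentiable.const_cpow (by fun_prop) (Or.inl hv)
    exact ((this.mul_const _).mul_const _).differentiableOn
  · have hr : 0 < (s.re + n / 2) / 2 := by
      have : -((n : ℝ) / 2) < s.re := hs
      linarith
    obtain ⟨W, hW, hb⟩ := exists_integrable_vertical_bound φ hδ hδ1
      (a := s.re - (s.re + n / 2) / 2) (by linarith) (s.re + (s.re + n / 2) / 2)
      (|s.im| + (s.re + n / 2) / 2)
    refine ⟨_, Metric.ball_mem_nhds s hr, W, hW, Eventually.of_forall fun y z hz => ?_⟩
    obtain ⟨h1, h2, h3⟩ := abs_re_sub_le_of_mem_ball hz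
    exact hb z h1 h2 h3 y

/-- On `Re v = δ` the factor `e^{|ξ|²v/4}` grows like `e^{δ|ξ|²/4}`; the weight `e^{-δ|ξ|²/2}` turns
it into the decaying Gaussian `e^{-(δ-iy)|ξ|²/4}`, and Fubini applies because the remaining factor
is integrable in `y`. -/
theorem integral_besselSymbol_mul_gaussian_of_re_pos (hn : 1 ≤ n)
    (φ : 𝓢(EuclideanSpace ℝ (Fin n), ℂ)) {s : ℂ} (hs : 0 < s.re) {δ : ℝ} (hδ : 0 < δ)
    (hδ1 : δ ≤ 1) :
    ∫ ξ, besselSymbol n s ξ * (((Real.exp (-(δ / 2) * ‖ξ‖ ^ 2) : ℝ) : ℂ) * invFourierCLM n φ ξ) =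
      (2 : ℂ) ^ s * (((2 * Real.pi : ℝ) : ℂ)⁻¹ * ∫ y : ℝ,
        ((δ : ℂ) + y * Complex.I) ^ (-(s + 1)) * Complex.exp (-((δ : ℂ) + y * Complex.I)⁻¹) *
          gaussPairing φ δ y) := by
  set ψ := invFourierCLM n φ
  set q : ℝ → ℂ := fun y => ((δ : ℂ) + y * Complex.I) ^ (-(s + 1)) *
    Complex.exp (-((δ : ℂ) + y * Complex.I)⁻¹) with hq
  have hv0 : ∀ y : ℝ, (δ : ℂ) + y * Complex.I ≠ 0 := fun y =>
    Complex.slitPlane_ne_zero (vertical_mem_slitPlane hδ y)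
  have hqi : Integrable q := by
    have h3 : Continuous fun y : ℝ => ((δ : ℂ) + y * Complex.I)⁻¹ :=
      Continuous.inv₀ (by fun_prop) hv0
    exact (integrable_vertical_cpow_neg hδ hδ1 (a := s + 1) (by simpa using hs)).mul_bdd (c := 1)
      (by fun_prop) (Eventually.of_forall fun y => norm_cexp_neg_inv_le_one (by simpa using hδ.le))
  have e1 : ∀ᵐ ξ : EuclideanSpace ℝ (Fin n), besselSymbol n s ξ *
      (((Real.exp (-(δ / 2) * ‖ξ‖ ^ 2) : ℝ) : ℂ) * ψ ξ) =
      (2 : ℂ) ^ s * (((2 * Real.pi : ℝ) : ℂ)⁻¹ * ∫ y : ℝ, q y *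
        (Complex.exp (-(((δ : ℂ) - y * Complex.I) / 4) * (‖ξ‖ : ℂ) ^ 2) * ψ ξ)) := by
    filter_upwards [ae_ne_zero hn] with ξ hξ
    have hx : 0 < ‖ξ‖ ^ 2 / 4 := by
      have : 0 < ‖ξ‖ := norm_pos_iff.2 hξ
      positivity
    rw [besselSymbol_eq s hξ, cpow_mul_besselSeries_eq_integral hδ hδ1 hx hs, mul_assoc, mul_assoc,
      ← integral_mul_const]
    congr 3 with y
    have h : Complex.exp (-(((δ : ℂ) - y * Complex.I) / 4) * (‖ξ‖ : ℂ) ^ 2) =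
        Complex.exp (((‖ξ‖ ^ 2 / 4 : ℝ) : ℂ) * ((δ : ℂ) + y * Complex.I)) *
          ((Real.exp (-(δ / 2) * ‖ξ‖ ^ 2) : ℝ) : ℂ) := by
      rw [Complex.ofReal_exp, ← Complex.exp_add]
      congr 1
      push_cast
      ring
    rw [h, hq]
    ring
  rw [integral_congr_ae e1, integral_const_mul, integral_const_mul]
  congr 2
  rw [integral_integral_swap]
  · congr 1 with y
    rw [integral_const_mul]
    rfl
  · have h1 : Integrable (fun p : EuclideanSpace ℝ (Fin n) × ℝ => ψ p.1 * q p.2)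
        (volume.prod volume) := ψ.integrable.mul_prod hqi
    refine (h1.bdd_mul (c := 1) (f := fun p : EuclideanSpace ℝ (Fin n) × ℝ =>
      Complex.exp (-(((δ : ℂ) - p.2 * Complex.I) / 4) * (‖p.1‖ : ℂ) ^ 2))
      (by fun_prop) (Eventually.of_forall fun p => norm_cexp_vertical_le_one hδ.le _ _)).congr
      (Eventually.of_forall fun p => ?_)
    simp only [Function.uncurry]
    ring

/-- Both sides are holomorphic on the larger half-plane, so the identity continues from `Re s > 0`.
-/
theorem integral_besselSymbol_mul_gaussian (hn : 1 ≤ n)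
    (φ : 𝓢(EuclideanSpace ℝ (Fin n), ℂ)) {s : ℂ} (hs : -((n : ℝ) / 2) < s.re) {δ : ℝ}
    (hδ : 0 < δ) (hδ1 : δ ≤ 1) :
    ∫ ξ, besselSymbol n s ξ * (((Real.exp (-(δ / 2) * ‖ξ‖ ^ 2) : ℝ) : ℂ) * invFourierCLM n φ ξ) =
      (2 : ℂ) ^ s * (((2 * Real.pi : ℝ) : ℂ)⁻¹ * ∫ y : ℝ,
        ((δ : ℂ) + y * Complex.I) ^ (-(s + 1)) * Complex.exp (-((δ : ℂ) + y * Complex.I)⁻¹) *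
          gaussPairing φ δ y) := by
  have hψ := (invFourierCLM n φ).continuous
  have hL := differentiableOn_integral_besselSymbol_mul hn
    (h := fun ξ => ((Real.exp (-(δ / 2) * ‖ξ‖ ^ 2) : ℝ) : ℂ) * invFourierCLM n φ ξ)
    (by fun_prop) (fun N => ⟨_, fun ξ => le_trans ?_ (schwartz_decay (invFourierCLM n φ) N ξ)⟩)
  · have hR : DifferentiableOn ℂ (fun s : ℂ => (2 : ℂ) ^ s * (((2 * Real.pi : ℝ) : ℂ)⁻¹ * ∫ y : ℝ,
        ((δ : ℂ) + y * Complex.I) ^ (-(s + 1)) * Complex.exp (-((δ : ℂ) + y * Complex.I)⁻¹) *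
          gaussPairing φ δ y)) {s | -((n : ℝ) / 2) < s.re} := by
      have h2 : Differentiable ℂ fun s : ℂ => (2 : ℂ) ^ s :=
        differentiable_id.const_cpow (Or.inl two_ne_zero)
      exact h2.differentiableOn.mul ((differentiableOn_integral_vertical φ hδ hδ1).const_mul _)
    exact eqOn_of_differentiableOn_of_subset (isOpen_re_gt _)
      (convex_halfSpace_re_gt _).isPreconnected hL hR (isOpen_re_gt 0)
      (fun z (hz : 0 < z.re) => by
        have : (0 : ℝ) ≤ n / 2 := by positivity
        exact lt_of_le_of_lt (by linarith) hz)
      ⟨1, by simp⟩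
      (fun z hz => integral_besselSymbol_mul_gaussian_of_re_pos hn φ hz hδ hδ1) hs
  · gcongr
    rw [norm_mul, Complex.norm_real, Real.norm_of_nonneg (Real.exp_pos _).le]
    refine mul_le_of_le_one_left (norm_nonneg _) (Real.exp_le_one_iff.2 ?_)
    nlinarith [sq_nonneg ‖ξ‖]

end

/-! ### Moving the contour to the imaginary axis -/

section

variable {n : ℕ}

/-- The integrand `v^(-(s+1)) e^{-1/v} Φ` on the vertical line `v = δ + iy`, with `Φ` the Gaussian
pairing at `(δ, y)`. -/
def verticalIntegrand (φ : 𝓢(EuclideanSpace ℝ (Fin n), ℂ)) (s : ℂ) (δ y : ℝ) : ℂ :=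
  ((δ : ℂ) + y * Complex.I) ^ (-(s + 1)) * Complex.exp (-((δ : ℂ) + y * Complex.I)⁻¹) *
    gaussPairing φ δ y

/-- For `y ≤ 1` the pairing is merely bounded and `y^{-(Re s + 1)}` is integrable since `Re s < 0`.
For `y > 1` its decay gives `y^{-(Re s + 1 + n/2)}`, integrable since `Re s > -n/2`. The sign `e`
selects the half-line. -/
theorem exists_integrable_verticalIntegrand_bound (φ : 𝓢(EuclideanSpace ℝ (Fin n), ℂ)) {s : ℂ}
    (hs : -((n : ℝ) / 2) < s.re) (hs0 : s.re < 0) :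
    ∃ W : ℝ → ℝ, Integrable W ∧ ∀ e : ℝ, |e| = 1 → ∀ δ : ℝ, 0 < δ → δ ≤ 1 → ∀ y : ℝ, 0 < y →
      ‖verticalIntegrand φ s δ (e * y)‖ ≤ W y := by
  obtain ⟨D, hD0, hD⟩ := exists_norm_gaussPairing_le φ
  set A : ℝ := ∫ ξ, ‖invFourierCLM n φ ξ‖ with hA
  have hA0 : 0 ≤ A := integral_nonneg fun _ => norm_nonneg _
  have hf1 : IntegrableOn (fun y : ℝ => (y ^ (-(s.re + 1)) + 2 ^ |s.re + 1|) * A)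
      (Set.Ioc 0 1) := by
    have h1 : IntegrableOn (fun y : ℝ => y ^ (-(s.re + 1))) (Set.Ioc 0 1) :=
      (intervalIntegrable_iff_integrableOn_Ioc_of_le zero_le_one).1
        (intervalIntegral.intervalIntegrable_rpow' (by linarith))
    exact (h1.add (integrableOn_const (by simp))).mul_const A
  have hf2 : IntegrableOn (fun y : ℝ => D * y ^ (-(s.re + 1 + n / 2))) (Set.Ioi 1) :=
    (integrableOn_Ioi_rpow_of_lt (by linarith) one_pos).const_mul D
  refine ⟨fun y => Real.exp (Real.pi * |s.im|) *
    ((Set.Ioc 0 1).indicator (fun y : ℝ => (y ^ (-(s.re + 1)) + 2 ^ |s.re + 1|) * A) y +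
      (Set.Ioi 1).indicator (fun y : ℝ => D * y ^ (-(s.re + 1 + n / 2))) y),
    ((hf1.integrable_indicator measurableSet_Ioc).add
      (hf2.integrable_indicator measurableSet_Ioi)).const_mul _, fun e he δ hδ hδ1 y hy => ?_⟩
  refine (norm_vertical_integrand_le φ s hδ (e * y)).trans ?_
  refine mul_le_mul_of_nonneg_left ?_ (Real.exp_pos _).le
  set v : ℂ := (δ : ℂ) + ((e * y : ℝ) : ℂ) * Complex.I with hv
  have hyv : y ≤ ‖v‖ := by
    have h := Complex.abs_im_le_norm v
    have him : v.im = e * y := by simp [hv]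
    rwa [him, abs_mul, he, one_mul, abs_of_pos hy] at h
  have hv0 : 0 < ‖v‖ := hy.trans_le hyv
  have hv1 : ‖v‖ ≤ 1 + y := by
    refine (norm_add_le _ _).trans ?_
    rw [norm_mul, Complex.norm_I, mul_one, Complex.norm_real, Complex.norm_real, Real.norm_eq_abs,
      Real.norm_eq_abs, abs_mul, he, one_mul, abs_of_pos hδ, abs_of_pos hy]
    linarith
  rcases le_or_gt y 1 with hy1 | hy1
  · rw [Set.indicator_of_mem (show y ∈ Set.Ioc 0 1 from ⟨hy, hy1⟩),
      Set.indicator_of_notMem (show y ∉ Set.Ioi 1 from not_lt.2 hy1), add_zero]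
    gcongr
    -- `Re s + 1` may be negative; the power then increases with `|v| ≤ 1 + y ≤ 2`, which is what
    -- the constant `2^|Re s + 1|` covers.
    · rcases le_total 0 (s.re + 1) with h | h
      · have h1 := Real.rpow_le_rpow_of_nonpos hy hyv (neg_nonpos.2 h)
        have h2 : (0 : ℝ) ≤ 2 ^ |s.re + 1| := by positivity
        linarith
      · have h1 : ‖v‖ ^ (-(s.re + 1)) ≤ 2 ^ |s.re + 1| := by
          rw [abs_of_nonpos h]
          exact Real.rpow_le_rpow hv0.le (by linarith) (by linarith)
        have h2 : 0 ≤ y ^ (-(s.re + 1)) := by positivity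
        linarith
    · exact norm_gaussPairing_le φ hδ.le _
  · rw [Set.indicator_of_notMem (show y ∉ Set.Ioc 0 1 from fun h => hy1.not_ge h.2),
      Set.indicator_of_mem (show y ∈ Set.Ioi 1 from hy1), zero_add]
    calc _ ≤ ‖v‖ ^ (-(s.re + 1)) * (D * ‖v‖ ^ (-((n : ℝ) / 2))) := by
          gcongr; exact hD δ hδ _
      _ = D * ‖v‖ ^ (-(s.re + 1 + n / 2)) := by
          rw [mul_left_comm, ← Real.rpow_add hv0]; congr 2; ring
      _ ≤ _ := by
          gcongr ?_ * ?_
          exact Real.rpow_le_rpow_of_nonpos hy hyv (by linarith)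

theorem tendsto_verticalIntegrand (φ : 𝓢(EuclideanSpace ℝ (Fin n), ℂ)) (s : ℂ) {y : ℝ}
    (hy : y ≠ 0) : Tendsto (fun δ => verticalIntegrand φ s δ y) (𝓝[>] 0)
      (𝓝 (verticalIntegrand φ s 0 y)) := by
  have hv : (((0 : ℝ) : ℂ) + y * Complex.I) ∈ Complex.slitPlane := Or.inr (by simpa using hy)
  have h1 : ContinuousAt (fun δ : ℝ => ((δ : ℂ) + y * Complex.I) ^ (-(s + 1))) 0 :=
    ContinuousAt.cpow (by fun_prop) continuousAt_const hv
  have h2 : ContinuousAt (fun δ : ℝ => ((δ : ℂ) + y * Complex.I)⁻¹) 0 :=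
    ContinuousAt.inv₀ (by fun_prop) (Complex.slitPlane_ne_zero hv)
  have h3 : ContinuousOn (fun δ : ℝ => gaussPairing φ δ y) (Set.Ici 0) :=
    (continuousOn_gaussPairing φ).comp (f := fun δ : ℝ => (δ, y)) (by fun_prop) fun δ hδ => hδ
  exact ((h1.mul h2.neg.cexp).tendsto.mono_left nhdsWithin_le_nhds).mul
    ((h3 0 Set.self_mem_Ici).mono_left (nhdsWithin_mono _ Set.Ioi_subset_Ici_self))

theorem Ioc_zero_one_mem_nhdsGT : Set.Ioc (0 : ℝ) 1 ∈ 𝓝[>] (0 : ℝ) := Ioc_mem_nhdsGT one_pos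

theorem integrableOn_verticalIntegrand_zero (φ : 𝓢(EuclideanSpace ℝ (Fin n), ℂ)) {s : ℂ}
    (hs : -((n : ℝ) / 2) < s.re) (hs0 : s.re < 0) {e : ℝ} (he : |e| = 1) :
    IntegrableOn (fun y => verticalIntegrand φ s 0 (e * y)) (Set.Ioi 0) ∧
      Tendsto (fun δ => ∫ y in Set.Ioi 0, verticalIntegrand φ s δ (e * y)) (𝓝[>] 0)
        (𝓝 (∫ y in Set.Ioi 0, verticalIntegrand φ s 0 (e * y))) := by
  obtain ⟨W, hW, hb⟩ := exists_integrable_verticalIntegrand_bound φ hs hs0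
  have he0 : e ≠ 0 := fun h => by simp [h] at he
  have hlim : ∀ᵐ y ∂volume.restrict (Set.Ioi (0 : ℝ)),
      Tendsto (fun δ => verticalIntegrand φ s δ (e * y)) (𝓝[>] 0)
        (𝓝 (verticalIntegrand φ s 0 (e * y))) :=
    (ae_restrict_iff' measurableSet_Ioi).2 (Eventually.of_forall fun y hy =>
      tendsto_verticalIntegrand φ s (mul_ne_zero he0 (show (0 : ℝ) < y from hy).ne'))
  have hmeas : ∀ δ, 0 ≤ δ → AEStronglyMeasurable (fun y => verticalIntegrand φ s δ (e * y))
      (volume.restrict (Set.Ioi (0 : ℝ))) := by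
    intro δ hδ
    have h1 := (continuous_gaussPairing φ hδ).measurable
    have : Measurable fun y => verticalIntegrand φ s δ (e * y) := by
      unfold verticalIntegrand
      fun_prop
    exact this.aestronglyMeasurable
  have hbd : ∀ᶠ δ in 𝓝[>] (0 : ℝ), ∀ᵐ y ∂volume.restrict (Set.Ioi (0 : ℝ)),
      ‖verticalIntegrand φ s δ (e * y)‖ ≤ W y := by
    filter_upwards [Ioc_zero_one_mem_nhdsGT] with δ hδ
    exact (ae_restrict_iff' measurableSet_Ioi).2 (Eventually.of_forall fun y hy =>
      hb e he δ hδ.1 hδ.2 y hy)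
  refine ⟨hW.integrableOn.mono' (hmeas 0 le_rfl) ?_,
    tendsto_integral_filter_of_dominated_convergence W ?_ hbd hW.integrableOn hlim⟩
  · filter_upwards [hlim, ae_restrict_mem measurableSet_Ioi] with y hy hy0
    refine le_of_tendsto hy.norm ?_
    filter_upwards [Ioc_zero_one_mem_nhdsGT] with δ hδ using hb e he δ hδ.1 hδ.2 y hy0
  · filter_upwards [self_mem_nhdsWithin] with δ hδ using hmeas δ (le_of_lt hδ)

theorem integral_eq_integral_Ioi_add {f : ℝ → ℂ} (hf : Integrable f) :
    ∫ y, f y = (∫ y in Set.Ioi 0, f (1 * y)) + ∫ y in Set.Ioi 0, f (-1 * y) := by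
  simp only [one_mul, neg_one_mul]
  rw [integral_comp_neg_Ioi, neg_zero, add_comm]
  exact (intervalIntegral.integral_Iic_add_Ioi hf.integrableOn hf.integrableOn).symm

/-- As `δ → 0+`, the same limit removes the Gaussian weight on the Fourier side and brings the
contour onto the imaginary axis. -/
theorem integral_besselSymbol_mul_eq (hn : 1 ≤ n) (φ : 𝓢(EuclideanSpace ℝ (Fin n), ℂ)) {s : ℂ}
    (hs : -((n : ℝ) / 2) < s.re) (hs0 : s.re < 0) :
    ∫ ξ, besselSymbol n s ξ * invFourierCLM n φ ξ =
      (2 : ℂ) ^ s * (((2 * Real.pi : ℝ) : ℂ)⁻¹ *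
        ((∫ y in Set.Ioi 0, verticalIntegrand φ s 0 (1 * y)) +
          ∫ y in Set.Ioi 0, verticalIntegrand φ s 0 (-1 * y))) := by
  have hi := (isTemperedIntegrable_besselSymbol hn hs).integrable_mul_schwartz (invFourierCLM n φ)
  have hψ := (invFourierCLM n φ).continuous
  have hL : Tendsto (fun δ : ℝ => ∫ ξ, besselSymbol n s ξ *
      (((Real.exp (-(δ / 2) * ‖ξ‖ ^ 2) : ℝ) : ℂ) * invFourierCLM n φ ξ)) (𝓝[>] 0)
      (𝓝 (∫ ξ, besselSymbol n s ξ * invFourierCLM n φ ξ)) := by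
    refine tendsto_integral_filter_of_dominated_convergence
      (fun ξ => ‖besselSymbol n s ξ * invFourierCLM n φ ξ‖)
      (Eventually.of_forall fun δ => (aestronglyMeasurable_besselSymbol hn s).mul
        (Continuous.aestronglyMeasurable (by fun_prop))) ?_ hi.norm
      (Eventually.of_forall fun ξ => ?_)
    · filter_upwards [self_mem_nhdsWithin] with δ hδ
      refine Eventually.of_forall fun ξ => ?_
      have hδ' : (0 : ℝ) < δ := hδ
      rw [mul_left_comm, norm_mul, Complex.norm_real, Real.norm_of_nonneg (Real.exp_pos _).le]
      refine mul_le_of_le_one_left (norm_nonneg _) (Real.exp_le_one_iff.2 ?_)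
      nlinarith [sq_nonneg ‖ξ‖]
    · have : Continuous fun δ : ℝ => besselSymbol n s ξ *
          (((Real.exp (-(δ / 2) * ‖ξ‖ ^ 2) : ℝ) : ℂ) * invFourierCLM n φ ξ) := by fun_prop
      have h0 := (this.tendsto 0).mono_left (nhdsWithin_le_nhds (s := Set.Ioi 0))
      simpa using h0
  have h1 := (integrableOn_verticalIntegrand_zero φ hs hs0 (e := 1) (by simp)).2
  have h2 := (integrableOn_verticalIntegrand_zero φ hs hs0 (e := -1) (by simp)).2
  refine tendsto_nhds_unique hL ((((h1.add h2).const_mul _).const_mul _).congr' ?_)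
  filter_upwards [Ioc_zero_one_mem_nhdsGT] with δ hδ
  rw [integral_besselSymbol_mul_gaussian hn φ hs hδ.1 hδ.2,
    integral_eq_integral_Ioi_add (integrable_vertical_integrand φ hs hδ.1 hδ.2)]
  rfl

/-- At `v = eiy`, `w = -eiy` one has `-1/v = 1/w = ei/y`, so `e^{-1/v}` and `e^{-|x|²/w}` merge.
This is where `1 - |x|²`, and with it the unit sphere, enters. -/
theorem verticalIntegrand_zero_eq (φ : 𝓢(EuclideanSpace ℝ (Fin n), ℂ)) (s : ℂ) {e : ℝ}
    (he : e ^ 2 = 1) {y : ℝ} (hy : 0 < y) :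
    verticalIntegrand φ s 0 (e * y) =
      gaussConst n * ((e * Complex.I) ^ (-(s + 1)) * (e * Complex.I) ^ ((n : ℂ) / 2)) *
        ((y : ℂ) ^ (-((n : ℂ) / 2 + s) - 1) * ∫ x : EuclideanSpace ℝ (Fin n),
          Complex.exp ((e * Complex.I * ((1 - ‖x‖ ^ 2 : ℝ) : ℂ)) * ((y⁻¹ : ℝ) : ℂ)) * φ x) := by
  have he0 : e ≠ 0 := fun h => by simp [h] at he
  have hec : (e : ℂ) ^ 2 = 1 := by exact_mod_cast he
  have hy0 : (y : ℂ) ≠ 0 := by exact_mod_cast hy.ne'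
  have heI : (e : ℂ) * Complex.I ≠ 0 := mul_ne_zero (by exact_mod_cast he0) Complex.I_ne_zero
  have e1 : (((0 : ℝ) : ℂ) + ((e * y : ℝ) : ℂ) * Complex.I) = (y : ℂ) * (e * Complex.I) := by
    push_cast; ring
  have e2 : (((0 : ℝ) : ℂ) - ((e * y : ℝ) : ℂ) * Complex.I)⁻¹ =
      ((y⁻¹ : ℝ) : ℂ) * (e * Complex.I) := by
    refine inv_eq_of_mul_eq_one_right ?_
    calc _ = -((e : ℂ) ^ 2 * Complex.I ^ 2) * ((y : ℂ) * (y : ℂ)⁻¹) := by push_cast; ring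
      _ = 1 := by rw [hec, Complex.I_sq, mul_inv_cancel₀ hy0]; ring
  have e3 : -(((0 : ℝ) : ℂ) + ((e * y : ℝ) : ℂ) * Complex.I)⁻¹ =
      ((y⁻¹ : ℝ) : ℂ) * (e * Complex.I) := by
    rw [← e2, neg_inv]
    congr 1
    push_cast; ring
  have e4 : ((y⁻¹ : ℝ) : ℂ) ^ ((n : ℂ) / 2) = (y : ℂ) ^ (-((n : ℂ) / 2)) := by
    rw [Complex.ofReal_inv, Complex.inv_cpow _ _ (by
      rw [Complex.arg_ofReal_of_nonneg hy.le]; exact Real.pi_pos.ne), Complex.cpow_neg]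
  have e5 : (y : ℂ) ^ (-((n : ℂ) / 2 + s) - 1) =
      (y : ℂ) ^ (-(s + 1)) * (y : ℂ) ^ (-((n : ℂ) / 2)) := by
    rw [← Complex.cpow_add _ _ hy0]; congr 1; ring
  rw [verticalIntegrand, gaussPairing_zero_eq φ (mul_ne_zero he0 hy.ne'), e3, e1, e2,
    Complex.ofReal_mul_cpow hy heI, Complex.ofReal_mul_cpow (inv_pos.2 hy) heI, e4, e5]
  have e6 : (∫ x : EuclideanSpace ℝ (Fin n),
      Complex.exp ((e * Complex.I * ((1 - ‖x‖ ^ 2 : ℝ) : ℂ)) * ((y⁻¹ : ℝ) : ℂ)) * φ x) =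
      Complex.exp (((y⁻¹ : ℝ) : ℂ) * (e * Complex.I)) * ∫ x : EuclideanSpace ℝ (Fin n),
        Complex.exp (-(‖x‖ : ℂ) ^ 2 * (((y⁻¹ : ℝ) : ℂ) * (e * Complex.I))) * φ x := by
    rw [← integral_const_mul]
    congr 1 with x
    rw [← mul_assoc, ← Complex.exp_add]
    congr 2
    push_cast
    ring
  rw [e6]
  ring

/-! ### The oscillatory integral and the explicit function -/

theorem integral_cpow_mul_cexp_neg_mul_inv {μ r : ℂ} (hμ : 0 < μ.re) (hr : 0 < r.re) :
    IntegrableOn (fun y : ℝ => (y : ℂ) ^ (-μ - 1) * Complex.exp (-r * ((y⁻¹ : ℝ) : ℂ)))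
        (Set.Ioi 0) ∧
      ∫ y : ℝ in Set.Ioi 0, (y : ℂ) ^ (-μ - 1) * Complex.exp (-r * ((y⁻¹ : ℝ) : ℂ)) =
        r ^ (-μ) * Complex.Gamma μ := by
  have h0 : MellinConvergent (fun t : ℝ => Complex.exp (-r * t)) μ :=
    integrableOn_cpow_mul_cexp hμ hr
  constructor
  · have := (MellinConvergent.comp_rpow (f := fun t : ℝ => Complex.exp (-r * t)) (s := -μ)
      (a := -1) (by norm_num)).2 (by simpa using h0)
    simp only [Real.rpow_neg_one] at this
    exact this
  · have := mellin_comp_inv (fun t : ℝ => Complex.exp (-r * t)) (-μ)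
    rw [neg_neg] at this
    rw [← integral_cpow_mul_cexp hμ hr]
    exact this

/-- The double integral is not absolutely convergent near `y = 0`. The Abel factor `e^{-κ/y}` makes
Fubini legitimate and the `y`-integral a Gamma integral; then `κ → 0+`. -/
theorem integral_cpow_mul_oscillatory (hn : 1 ≤ n) (φ : 𝓢(EuclideanSpace ℝ (Fin n), ℂ)) {μ : ℂ}
    (hμ0 : 0 < μ.re) (hμ1 : μ.re < 1) {e : ℝ} (he : |e| = 1)
    (hint : IntegrableOn (fun y : ℝ => (y : ℂ) ^ (-μ - 1) * ∫ x : EuclideanSpace ℝ (Fin n),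
      Complex.exp ((e * Complex.I * ((1 - ‖x‖ ^ 2 : ℝ) : ℂ)) * ((y⁻¹ : ℝ) : ℂ)) * φ x)
      (Set.Ioi 0)) :
    (Integrable fun x : EuclideanSpace ℝ (Fin n) =>
        (-(e * Complex.I * ((1 - ‖x‖ ^ 2 : ℝ) : ℂ))) ^ (-μ) * φ x) ∧
    ∫ y : ℝ in Set.Ioi 0, (y : ℂ) ^ (-μ - 1) * (∫ x : EuclideanSpace ℝ (Fin n),
      Complex.exp ((e * Complex.I * ((1 - ‖x‖ ^ 2 : ℝ) : ℂ)) * ((y⁻¹ : ℝ) : ℂ)) * φ x) =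
      Complex.Gamma μ * ∫ x : EuclideanSpace ℝ (Fin n),
        (-(e * Complex.I * ((1 - ‖x‖ ^ 2 : ℝ) : ℂ))) ^ (-μ) * φ x := by
  set z : EuclideanSpace ℝ (Fin n) → ℂ := fun x => e * Complex.I * ((1 - ‖x‖ ^ 2 : ℝ) : ℂ) with hz
  have hzc : Continuous z := by fun_prop
  have hφc := φ.continuous
  have hzre : ∀ x, (z x).re = 0 := fun x => by
    simp only [hz, Complex.re_mul_ofReal]; simp
  have hzim : ∀ x, |(z x).im| = |‖x‖ ^ 2 - 1| := fun x => by
    simp only [hz, Complex.im_mul_ofReal]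
    simp [abs_mul, he, abs_sub_comm]
  set P : ℝ → ℂ := fun y => ∫ x, Complex.exp (z x * ((y⁻¹ : ℝ) : ℂ)) * φ x with hP
  have hreg : ∀ κ : ℝ, 0 < κ → ∫ y : ℝ in Set.Ioi 0,
      ((Real.exp (-κ * y⁻¹) : ℝ) : ℂ) * ((y : ℂ) ^ (-μ - 1) * P y) =
      Complex.Gamma μ * ∫ x, ((κ : ℂ) - z x) ^ (-μ) * φ x := by
    intro κ hκ
    set q : ℝ → ℂ := fun y => (y : ℂ) ^ (-μ - 1) * Complex.exp (-(κ : ℂ) * ((y⁻¹ : ℝ) : ℂ)) with hq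
    have hqi : IntegrableOn q (Set.Ioi 0) :=
      (integral_cpow_mul_cexp_neg_mul_inv hμ0 (r := κ) (by simpa using hκ)).1
    calc _ = ∫ y : ℝ in Set.Ioi 0, ∫ x, q y * (Complex.exp (z x * ((y⁻¹ : ℝ) : ℂ)) * φ x) := by
          congr 1 with y
          rw [integral_const_mul, hq, hP]
          push_cast
          ring
      _ = ∫ x, ∫ y : ℝ in Set.Ioi 0, q y * (Complex.exp (z x * ((y⁻¹ : ℝ) : ℂ)) * φ x) := by
          rw [integral_integral_swap]
          have h1 : Integrable (fun p : ℝ × EuclideanSpace ℝ (Fin n) => q p.1 * φ p.2)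
              ((volume.restrict (Set.Ioi 0)).prod volume) := hqi.mul_prod φ.integrable
          refine (h1.bdd_mul (c := 1) (f := fun p : ℝ × EuclideanSpace ℝ (Fin n) =>
            Complex.exp (z p.2 * ((p.1⁻¹ : ℝ) : ℂ))) ?_
            (Eventually.of_forall fun p => ?_)).congr (Eventually.of_forall fun p => ?_)
          · have : Measurable fun p : ℝ × EuclideanSpace ℝ (Fin n) =>
                Complex.exp (z p.2 * ((p.1⁻¹ : ℝ) : ℂ)) := by
              have := hzc.measurable
              fun_prop
            exact this.aestronglyMeasurable
          · rw [Complex.norm_exp, Complex.re_mul_ofReal, hzre, zero_mul, Real.exp_zero]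
          · simp only [Function.uncurry]
            ring
      _ = ∫ x, Complex.Gamma μ * (((κ : ℂ) - z x) ^ (-μ) * φ x) := by
          congr 1 with x
          have hr : 0 < ((κ : ℂ) - z x).re := by
            rw [Complex.sub_re, hzre, Complex.ofReal_re, sub_zero]; exact hκ
          rw [← mul_assoc, mul_comm (Complex.Gamma μ),
            ← (integral_cpow_mul_cexp_neg_mul_inv hμ0 hr).2, ← integral_mul_const]
          congr 1 with y
          rw [hq, ← mul_assoc]
          simp only
          rw [mul_assoc ((y : ℂ) ^ _), ← Complex.exp_add]
          congr 4
          ring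
      _ = _ := integral_const_mul _ _
  have hL : Tendsto (fun κ : ℝ => ∫ y : ℝ in Set.Ioi 0,
      ((Real.exp (-κ * y⁻¹) : ℝ) : ℂ) * ((y : ℂ) ^ (-μ - 1) * P y)) (𝓝[>] 0)
      (𝓝 (∫ y : ℝ in Set.Ioi 0, (y : ℂ) ^ (-μ - 1) * P y)) := by
    refine tendsto_integral_filter_of_dominated_convergence
      (fun y => ‖(y : ℂ) ^ (-μ - 1) * P y‖) (Eventually.of_forall fun κ => ?_) ?_ hint.norm
      (Eventually.of_forall fun y => ?_)
    · exact (by fun_prop : Measurable fun y : ℝ =>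
        ((Real.exp (-κ * y⁻¹) : ℝ) : ℂ)).aestronglyMeasurable.mul hint.aestronglyMeasurable
    · filter_upwards [self_mem_nhdsWithin] with κ hκ
      refine (ae_restrict_iff' measurableSet_Ioi).2 (Eventually.of_forall fun y hy => ?_)
      have hκ' : (0 : ℝ) < κ := hκ
      have hy' : (0 : ℝ) < y := hy
      rw [norm_mul, Complex.norm_real, Real.norm_of_nonneg (Real.exp_pos _).le]
      refine mul_le_of_le_one_left (norm_nonneg _) (Real.exp_le_one_iff.2 ?_)
      rw [neg_mul, neg_nonpos]
      positivity
    · have : Continuous fun κ : ℝ =>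
          ((Real.exp (-κ * y⁻¹) : ℝ) : ℂ) * ((y : ℂ) ^ (-μ - 1) * P y) := by fun_prop
      have h0 := (this.tendsto 0).mono_left (nhdsWithin_le_nhds (s := Set.Ioi 0))
      simpa using h0
  set b : EuclideanSpace ℝ (Fin n) → ℝ := fun x =>
    Real.exp (Real.pi * |μ.im|) * (|‖x‖ ^ 2 - 1| ^ (-μ.re) * ‖φ x‖) with hb
  have hbi : Integrable b := (integrable_rpow_mul_schwartz hn hμ0.le hμ1 φ).const_mul _
  have hbound : ∀ κ : ℝ, ∀ᵐ x : EuclideanSpace ℝ (Fin n),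
      ‖((κ : ℂ) - z x) ^ (-μ) * φ x‖ ≤ b x := by
    intro κ
    filter_upwards [ae_abs_norm_sq_sub_one_pos hn] with x hx
    have h1 := Complex.norm_cpow_le_rpow_mul_exp ((κ : ℂ) - z x) (-μ)
    rw [Complex.neg_re, Complex.neg_im, abs_neg] at h1
    -- `z` is purely imaginary, so the imaginary part alone gives a bound uniform in `κ`; its power
    -- is integrable against `φ` because `Re μ < 1`.
    have h2 : |‖x‖ ^ 2 - 1| ≤ ‖(κ : ℂ) - z x‖ := by
      have := Complex.abs_im_le_norm ((κ : ℂ) - z x)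
      rwa [Complex.sub_im, Complex.ofReal_im, zero_sub, abs_neg, hzim] at this
    have h3 := Real.rpow_le_rpow_of_nonpos hx h2 (neg_nonpos.2 hμ0.le)
    rw [norm_mul, hb]
    calc _ ≤ ‖(κ : ℂ) - z x‖ ^ (-μ.re) * Real.exp (Real.pi * |μ.im|) * ‖φ x‖ := by gcongr
      _ ≤ |‖x‖ ^ 2 - 1| ^ (-μ.re) * Real.exp (Real.pi * |μ.im|) * ‖φ x‖ := by gcongr
      _ = _ := by ring
  have hmeas : ∀ κ : ℝ, AEStronglyMeasurable (fun x => ((κ : ℂ) - z x) ^ (-μ) * φ x) := by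
    intro κ
    have h1 := hzc.measurable
    have h2 := hφc.measurable
    exact (by fun_prop : Measurable fun x => ((κ : ℂ) - z x) ^ (-μ) * φ x).aestronglyMeasurable
  have hR : Tendsto (fun κ : ℝ => ∫ x, ((κ : ℂ) - z x) ^ (-μ) * φ x) (𝓝[>] 0)
      (𝓝 (∫ x, (-z x) ^ (-μ) * φ x)) := by
    refine tendsto_integral_filter_of_dominated_convergence b (Eventually.of_forall hmeas)
      (Eventually.of_forall hbound) hbi ?_
    filter_upwards [ae_abs_norm_sq_sub_one_pos hn] with x hx
    have hsl : ((0 : ℝ) : ℂ) - z x ∈ Complex.slitPlane := by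
      refine Or.inr fun h => ?_
      rw [Complex.sub_im, Complex.ofReal_im, zero_sub, neg_eq_zero] at h
      rw [← hzim, h, abs_zero] at hx
      exact lt_irrefl _ hx
    have h0 : ContinuousAt (fun κ : ℝ => ((κ : ℂ) - z x) ^ (-μ)) 0 :=
      ContinuousAt.cpow (by fun_prop) continuousAt_const hsl
    have h1 : ContinuousAt (fun κ : ℝ => ((κ : ℂ) - z x) ^ (-μ) * φ x) 0 :=
      h0.mul continuousAt_const
    have h2 := h1.tendsto.mono_left (nhdsWithin_le_nhds (s := Set.Ioi 0))
    simpa using h2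
  refine ⟨?_, tendsto_nhds_unique hL ((hR.const_mul (Complex.Gamma μ)).congr' ?_)⟩
  · have h1 := hbi.mono' (hmeas 0) (hbound 0)
    simpa only [Complex.ofReal_zero, zero_sub] using h1
  · filter_upwards [self_mem_nhdsWithin] with κ hκ using (hreg κ hκ).symm

theorem gaussConst_eq (n : ℕ) : gaussConst n = ((Real.pi : ℂ) ^ ((n : ℂ) / 2))⁻¹ := by
  have hpi : (Real.pi : ℂ) ≠ 0 := by exact_mod_cast Real.pi_ne_zero
  have h4 : (((2 * 2 : ℝ)) : ℂ) ^ ((n : ℂ) / 2) = 2 ^ n := by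
    rw [Complex.ofReal_mul, Complex.mul_cpow_ofReal_nonneg (by norm_num) (by norm_num),
      ← Complex.cpow_add _ _ (by norm_num), add_halves, Complex.cpow_natCast]
    norm_num
  have hp : (Real.pi : ℂ) ^ ((n : ℂ) / 2) * (Real.pi : ℂ) ^ ((n : ℂ) / 2) = (Real.pi : ℂ) ^ n := by
    rw [← Complex.cpow_add _ _ hpi, add_halves, Complex.cpow_natCast]
  have hp0 : (Real.pi : ℂ) ^ ((n : ℂ) / 2) ≠ 0 := by
    rw [Complex.cpow_ne_zero_iff]; exact Or.inl hpi
  rw [gaussConst, show (4 * Real.pi : ℝ) = (2 * 2 : ℝ) * Real.pi by ring,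
    Complex.ofReal_mul (2 * 2), Complex.mul_cpow_ofReal_nonneg (by norm_num) Real.pi_pos.le, h4]
  refine eq_inv_of_mul_eq_one_left ?_
  rw [mul_assoc, mul_assoc, hp, Complex.ofReal_mul 2, Complex.ofReal_ofNat, ← mul_pow, inv_pow,
    inv_mul_cancel₀ (pow_ne_zero _ (mul_ne_zero two_ne_zero hpi))]

theorem I_cpow (a : ℂ) : Complex.I ^ a = Complex.exp (Real.pi / 2 * Complex.I * a) := by
  rw [Complex.cpow_def_of_ne_zero Complex.I_ne_zero, Complex.log_I]

theorem neg_I_cpow (a : ℂ) : (-Complex.I) ^ a = Complex.exp (-(Real.pi / 2 * Complex.I * a)) := by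
  rw [Complex.cpow_def_of_ne_zero (neg_ne_zero.2 Complex.I_ne_zero), Complex.log_neg_I]
  congr 1
  ring

/-- Inside the sphere `s` cancels from the phases, which are `-i e^{inπ/2}` and `i e^{-inπ/2}`, with
sum `2 sin(nπ/2)`. Outside, `n` cancels: `-i e^{-isπ}` and `i e^{isπ}` add up to `-2 sin(sπ)`. -/
theorem besselTransform_eq (s : ℂ) {x : EuclideanSpace ℝ (Fin n)} (hx : 0 < |‖x‖ ^ 2 - 1|) :
    besselTransform n s x = (2 : ℂ) ^ s * (((2 * Real.pi : ℝ) : ℂ)⁻¹ *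
      (gaussConst n * (Complex.I ^ (-(s + 1)) * Complex.I ^ ((n : ℂ) / 2)) *
          (Complex.Gamma ((n : ℂ) / 2 + s) *
            (-(Complex.I * ((1 - ‖x‖ ^ 2 : ℝ) : ℂ))) ^ (-((n : ℂ) / 2 + s))) +
        gaussConst n * ((-Complex.I) ^ (-(s + 1)) * (-Complex.I) ^ ((n : ℂ) / 2)) *
          (Complex.Gamma ((n : ℂ) / 2 + s) *
            (-(-Complex.I * ((1 - ‖x‖ ^ 2 : ℝ) : ℂ))) ^ (-((n : ℂ) / 2 + s))))) := by
  have hpi : (Real.pi : ℂ) ≠ 0 := by exact_mod_cast Real.pi_ne_zero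
  have hp0 : (Real.pi : ℂ) ^ ((n : ℂ) / 2) ≠ 0 := by
    rw [Complex.cpow_ne_zero_iff]; exact Or.inl hpi
  have hI2 : Complex.exp (-(Real.pi / 2 * Complex.I)) = -Complex.I := by
    rw [← Complex.log_I, Complex.exp_neg, Complex.exp_log Complex.I_ne_zero, Complex.inv_I]
  have hI1 : Complex.exp (Real.pi / 2 * Complex.I) = Complex.I := by
    rw [← Complex.log_I, Complex.exp_log Complex.I_ne_zero]
  rw [gaussConst_eq, besselTransform, Complex.cpow_add _ _ hpi, Complex.cpow_one,
    show -((n : ℂ) / 2) - s = -((n : ℂ) / 2 + s) by ring]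
  split_ifs with h1 h2
  · have hp : 0 < 1 - ‖x‖ ^ 2 := by nlinarith [norm_nonneg x]
    have k1 : -(Complex.I * ((1 - ‖x‖ ^ 2 : ℝ) : ℂ)) =
        ((1 - ‖x‖ ^ 2 : ℝ) : ℂ) * -Complex.I := by ring
    have k2 : -(-Complex.I * ((1 - ‖x‖ ^ 2 : ℝ) : ℂ)) =
        ((1 - ‖x‖ ^ 2 : ℝ) : ℂ) * Complex.I := by ring
    rw [k1, k2, Complex.ofReal_mul_cpow hp (neg_ne_zero.2 Complex.I_ne_zero),
      Complex.ofReal_mul_cpow hp Complex.I_ne_zero]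
    have t1 : Complex.I ^ (-(s + 1)) * Complex.I ^ ((n : ℂ) / 2) *
        (-Complex.I) ^ (-((n : ℂ) / 2 + s)) =
        Complex.exp ((n : ℂ) * Real.pi / 2 * Complex.I) * -Complex.I := by
      rw [I_cpow, I_cpow, neg_I_cpow, ← Complex.exp_add, ← Complex.exp_add, ← hI2,
        ← Complex.exp_add]
      congr 1
      ring
    have t2 : (-Complex.I) ^ (-(s + 1)) * (-Complex.I) ^ ((n : ℂ) / 2) *
        Complex.I ^ (-((n : ℂ) / 2 + s)) =
        Complex.exp (-((n : ℂ) * Real.pi / 2) * Complex.I) * Complex.I := by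
      rw [neg_I_cpow, neg_I_cpow, I_cpow, ← Complex.exp_add, ← Complex.exp_add, ← hI1,
        ← Complex.exp_add, hI1]
      congr 1
      ring
    rw [Complex.sin]
    generalize ((1 - ‖x‖ ^ 2 : ℝ) : ℂ) ^ (-((n : ℂ) / 2 + s)) = Y
    generalize Complex.I ^ (-(s + 1)) = a1 at *
    generalize Complex.I ^ ((n : ℂ) / 2) = a2 at *
    generalize (-Complex.I) ^ (-(s + 1)) = b1 at *
    generalize (-Complex.I) ^ ((n : ℂ) / 2) = b2 at *
    generalize Complex.I ^ (-((n : ℂ) / 2 + s)) = a3 at *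
    generalize (-Complex.I) ^ (-((n : ℂ) / 2 + s)) = b3 at *
    generalize Complex.exp ((n : ℂ) * Real.pi / 2 * Complex.I) = E1 at *
    generalize Complex.exp (-((n : ℂ) * Real.pi / 2) * Complex.I) = E2 at *
    generalize Complex.Gamma ((n : ℂ) / 2 + s) = G
    push_cast
    field_simp
    linear_combination (-G * Y) * (t1 + t2)
  · have hp : 0 < ‖x‖ ^ 2 - 1 := by nlinarith [norm_nonneg x]
    have k1 : -(Complex.I * ((1 - ‖x‖ ^ 2 : ℝ) : ℂ)) =
        ((‖x‖ ^ 2 - 1 : ℝ) : ℂ) * Complex.I := by push_cast; ring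
    have k2 : -(-Complex.I * ((1 - ‖x‖ ^ 2 : ℝ) : ℂ)) =
        ((‖x‖ ^ 2 - 1 : ℝ) : ℂ) * -Complex.I := by push_cast; ring
    rw [k1, k2, Complex.ofReal_mul_cpow hp (neg_ne_zero.2 Complex.I_ne_zero),
      Complex.ofReal_mul_cpow hp Complex.I_ne_zero]
    have t1 : Complex.I ^ (-(s + 1)) * Complex.I ^ ((n : ℂ) / 2) *
        Complex.I ^ (-((n : ℂ) / 2 + s)) =
        Complex.exp (-(s * Real.pi) * Complex.I) * -Complex.I := by
      rw [I_cpow, I_cpow, I_cpow, ← Complex.exp_add, ← Complex.exp_add, ← hI2,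
        ← Complex.exp_add]
      congr 1
      ring
    have t2 : (-Complex.I) ^ (-(s + 1)) * (-Complex.I) ^ ((n : ℂ) / 2) *
        (-Complex.I) ^ (-((n : ℂ) / 2 + s)) =
        Complex.exp (s * Real.pi * Complex.I) * Complex.I := by
      rw [neg_I_cpow, neg_I_cpow, neg_I_cpow, ← Complex.exp_add, ← Complex.exp_add, ← hI1,
        ← Complex.exp_add, hI1]
      congr 1
      ring
    rw [Complex.sin]
    generalize ((‖x‖ ^ 2 - 1 : ℝ) : ℂ) ^ (-((n : ℂ) / 2 + s)) = Y
    generalize Complex.I ^ (-(s + 1)) = a1 at *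
    generalize Complex.I ^ ((n : ℂ) / 2) = a2 at *
    generalize (-Complex.I) ^ (-(s + 1)) = b1 at *
    generalize (-Complex.I) ^ ((n : ℂ) / 2) = b2 at *
    generalize Complex.I ^ (-((n : ℂ) / 2 + s)) = a3 at *
    generalize (-Complex.I) ^ (-((n : ℂ) / 2 + s)) = b3 at *
    generalize Complex.exp (s * Real.pi * Complex.I) = E1 at *
    generalize Complex.exp (-(s * Real.pi) * Complex.I) = E2 at *
    generalize Complex.Gamma ((n : ℂ) / 2 + s) = G
    push_cast
    field_simp
    linear_combination (-G * Y) * (t1 + t2)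
  · exfalso
    have h3 : ‖x‖ = 1 := le_antisymm (not_lt.1 h2) (not_lt.1 h1)
    rw [h3] at hx
    simp at hx

end

/-! ### Identification on the strip and analytic continuation in the order -/

section

variable {n : ℕ}

theorem integral_besselSymbol_mul_eq_of_re_neg (hn : 1 ≤ n)
    (φ : 𝓢(EuclideanSpace ℝ (Fin n), ℂ)) {s : ℂ} (hs : -((n : ℝ) / 2) < s.re) (hs0 : s.re < 0)
    (hs1 : s.re < 1 - (n : ℝ) / 2) :
    ∫ ξ, besselSymbol n s ξ * invFourierCLM n φ ξ = ∫ x, besselTransform n s x * φ x := by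
  have hre : ((n : ℂ) / 2 + s).re = (n : ℝ) / 2 + s.re := by simp
  have hμ0 : 0 < ((n : ℂ) / 2 + s).re := by rw [hre]; linarith
  have hμ1 : ((n : ℂ) / 2 + s).re < 1 := by rw [hre]; linarith
  have key : ∀ e : ℝ, |e| = 1 → (Integrable fun x : EuclideanSpace ℝ (Fin n) =>
      (-(e * Complex.I * ((1 - ‖x‖ ^ 2 : ℝ) : ℂ))) ^ (-((n : ℂ) / 2 + s)) * φ x) ∧
      ∫ y in Set.Ioi 0, verticalIntegrand φ s 0 (e * y) =
        gaussConst n * ((e * Complex.I) ^ (-(s + 1)) * (e * Complex.I) ^ ((n : ℂ) / 2)) *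
          (Complex.Gamma ((n : ℂ) / 2 + s) * ∫ x : EuclideanSpace ℝ (Fin n),
            (-(e * Complex.I * ((1 - ‖x‖ ^ 2 : ℝ) : ℂ))) ^ (-((n : ℂ) / 2 + s)) * φ x) := by
    intro e he
    have he2 : e ^ 2 = 1 := by rw [← sq_abs, he, one_pow]
    have he0 : (e : ℂ) * Complex.I ≠ 0 := by
      refine mul_ne_zero (fun h => ?_) Complex.I_ne_zero
      rw [Complex.ofReal_eq_zero.1 h] at he
      simp at he
    have hc : gaussConst n *
        ((e * Complex.I) ^ (-(s + 1)) * (e * Complex.I) ^ ((n : ℂ) / 2)) ≠ 0 := by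
      rw [gaussConst_eq]
      refine mul_ne_zero (inv_ne_zero ?_) (mul_ne_zero ?_ ?_) <;> rw [Complex.cpow_ne_zero_iff]
      · exact Or.inl (by exact_mod_cast Real.pi_ne_zero)
      · exact Or.inl he0
      · exact Or.inl he0
    have hV := (integrableOn_verticalIntegrand_zero φ hs hs0 he).1
    have hVe : Set.EqOn (fun y => verticalIntegrand φ s 0 (e * y)) _ (Set.Ioi 0) :=
      fun y hy => verticalIntegrand_zero_eq φ s he2 hy
    -- The phase constant is nonzero, so integrability of the limiting vertical integrand passes to
    -- the oscillatory integrand.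
    have hint := (integrable_const_mul_iff (isUnit_iff_ne_zero.2 hc) _).1
      (hV.congr_fun hVe measurableSet_Ioi)
    obtain ⟨h1, h2⟩ := integral_cpow_mul_oscillatory hn φ hμ0 hμ1 he hint
    exact ⟨h1, by rw [setIntegral_congr_fun measurableSet_Ioi hVe, integral_const_mul, h2]⟩
  obtain ⟨i1, k1⟩ := key 1 (by simp)
  obtain ⟨i2, k2⟩ := key (-1) (by simp)
  rw [integral_besselSymbol_mul_eq hn φ hs hs0, k1, k2]
  simp only [Complex.ofReal_one, one_mul, Complex.ofReal_neg, neg_one_mul] at i1 i2 ⊢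
  rw [← integral_const_mul, ← integral_const_mul, ← integral_const_mul, ← integral_const_mul,
    ← integral_add ((i1.const_mul _).const_mul _) ((i2.const_mul _).const_mul _),
    ← integral_const_mul, ← integral_const_mul]
  refine integral_congr_ae ?_
  filter_upwards [ae_abs_norm_sq_sub_one_pos hn] with x hx
  rw [besselTransform_eq s hx]
  ring

theorem differentiableOn_integral_besselSymbol_mul_invFourier (hn : 1 ≤ n)
    (φ : 𝓢(EuclideanSpace ℝ (Fin n), ℂ)) :
    DifferentiableOn ℂ (fun s => ∫ ξ, besselSymbol n s ξ * invFourierCLM n φ ξ)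
      {s | -((n : ℝ) / 2) < s.re} :=
  differentiableOn_integral_besselSymbol_mul hn (invFourierCLM n φ).continuous
    fun N => ⟨_, schwartz_decay (invFourierCLM n φ) N⟩

/-- The direct computation also needed `Re s < 0`; the identity theorem removes this. Leaving `U`
general serves both the strip of local integrability and, for `φ` supported off the sphere, the
whole half-plane. -/
theorem integral_besselSymbol_mul_eq_of_subset (hn : 1 ≤ n)
    (φ : 𝓢(EuclideanSpace ℝ (Fin n), ℂ)) {U : Set ℂ} (hU : IsOpen U) (hUc : IsPreconnected U)
    (hUs : U ⊆ {s | -((n : ℝ) / 2) < s.re})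
    (hstrip : {s : ℂ | -((n : ℝ) / 2) < s.re ∧ s.re < 1 - (n : ℝ) / 2} ⊆ U)
    (hi : ∀ s ∈ U, Integrable fun x => |‖x‖ ^ 2 - 1| ^ (-((n : ℝ) / 2 + s.re)) * ‖φ x‖) :
    Set.EqOn (fun s => ∫ ξ, besselSymbol n s ξ * invFourierCLM n φ ξ)
      (fun s => ∫ x, besselTransform n s x * φ x) U := by
  have hn1 : (1 : ℝ) ≤ n := by exact_mod_cast hn
  refine eqOn_of_differentiableOn_of_subset hU hUc
    ((differentiableOn_integral_besselSymbol_mul_invFourier hn φ).mono hUs)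
    (differentiableOn_integral_besselTransform_mul hn hU hUs φ.continuous hi)
    (V := {s : ℂ | -((n : ℝ) / 2) < s.re ∧ s.re < min 0 (1 - (n : ℝ) / 2)})
    ((isOpen_re_gt _).inter (isOpen_lt Complex.continuous_re continuous_const))
    (fun s hs => hstrip ⟨hs.1, hs.2.trans_le (min_le_right _ _)⟩) ?_ fun s hs =>
      integral_besselSymbol_mul_eq_of_re_neg hn φ hs.1 (hs.2.trans_le (min_le_left _ _))
        (hs.2.trans_le (min_le_right _ _))
  -- A point of the smaller strip: `-n/2 + 1/4` is negative because `n ≥ 1`.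
  refine ⟨((-((n : ℝ) / 2) + 1 / 4 : ℝ) : ℂ), ?_, ?_⟩
  · rw [Complex.ofReal_re]; linarith
  · rw [Complex.ofReal_re, lt_min_iff]; constructor <;> linarith

theorem integrable_rpow_mul_schwartz_of_mem_strip (hn : 1 ≤ n)
    (φ : 𝓢(EuclideanSpace ℝ (Fin n), ℂ)) {s : ℂ} (hs : -((n : ℝ) / 2) < s.re)
    (hs1 : s.re < 1 - (n : ℝ) / 2) :
    Integrable fun x => |‖x‖ ^ 2 - 1| ^ (-((n : ℝ) / 2 + s.re)) * ‖φ x‖ :=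
  integrable_rpow_mul_schwartz hn (by linarith) (by linarith) φ

theorem integral_besselSymbol_mul_eq_of_mem_strip (hn : 1 ≤ n)
    (φ : 𝓢(EuclideanSpace ℝ (Fin n), ℂ)) {s : ℂ} (hs : -((n : ℝ) / 2) < s.re)
    (hs1 : s.re < 1 - (n : ℝ) / 2) :
    ∫ ξ, besselSymbol n s ξ * invFourierCLM n φ ξ = ∫ x, besselTransform n s x * φ x :=
  integral_besselSymbol_mul_eq_of_subset hn φ
    (U := {s : ℂ | -((n : ℝ) / 2) < s.re} ∩ {s : ℂ | s.re < 1 - (n : ℝ) / 2})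
    ((isOpen_re_gt _).inter (isOpen_lt Complex.continuous_re continuous_const))
    ((convex_halfSpace_re_gt _).inter (convex_halfSpace_re_lt _)).isPreconnected
    Set.inter_subset_left (fun _ h => h)
    (fun _ h => integrable_rpow_mul_schwartz_of_mem_strip hn φ h.1 h.2) ⟨hs, hs1⟩

theorem integral_besselSymbol_mul_eq_of_disjoint (hn : 1 ≤ n)
    (φ : 𝓢(EuclideanSpace ℝ (Fin n), ℂ))
    (hd : Disjoint (tsupport φ) (Metric.sphere (0 : EuclideanSpace ℝ (Fin n)) 1)) {s : ℂ}
    (hs : -((n : ℝ) / 2) < s.re) :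
    ∫ ξ, besselSymbol n s ξ * invFourierCLM n φ ξ = ∫ x, besselTransform n s x * φ x :=
  integral_besselSymbol_mul_eq_of_subset hn φ (isOpen_re_gt _)
    (convex_halfSpace_re_gt _).isPreconnected subset_rfl (fun _ h => h.1)
    (fun s (h : -((n : ℝ) / 2) < s.re) =>
      integrable_rpow_mul_schwartz_of_disjoint (by linarith) φ hd) hs

end

end

theorem theorem3p2 (n : ℕ) (hn : 1 ≤ n) (ν : ℂ) (hν : |ν.re| < 1 / 2) :
    ∃ T : 𝓢'(EuclideanSpace ℝ (Fin n), ℂ),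
      -- `T` is the inverse Fourier transform of `|ξ|^ν J_ν(|ξ|)`, and the limit of the damped ones
      IsInvFourierTransform (besselSymbol n ν) T ∧
      IsDampedInvFourierLimit (besselSymbol n ν) T ∧
      -- off the unit sphere `T` is the explicit function
      (∀ φ : 𝓢(EuclideanSpace ℝ (Fin n), ℂ),
        Disjoint (tsupport φ) (Metric.sphere (0 : EuclideanSpace ℝ (Fin n)) 1) →
          RepresentsOn (besselTransform n ν) T φ) ∧
      -- if the explicit function is locally integrable, it is `T` on all of `ℝⁿ`
      ((n : ℝ) / 2 + ν.re < 1 → ∀ φ : 𝓢(EuclideanSpace ℝ (Fin n), ℂ),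
        RepresentsOn (besselTransform n ν) T φ) ∧
      -- in every case `T` is the regularized distribution defined by the explicit function
      (∀ φ : 𝓢(EuclideanSpace ℝ (Fin n), ℂ), IsRegularizedPairing n ν φ (T φ)) := by
  have hn1 : (1 : ℝ) ≤ n := by exact_mod_cast hn
  have hs : -((n : ℝ) / 2) < ν.re := by linarith [(abs_lt.1 hν).1]
  have hg := isTemperedIntegrable_besselSymbol hn hs
  refine ⟨hg.invFourier, hg.isInvFourierTransform, hg.isDampedInvFourierLimit, fun φ hd => ?_,
    fun h φ => ?_, fun φ => ?_⟩
  · exact ⟨integrable_besselTransform_mul hs φ.continuous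
      (integrable_rpow_mul_schwartz_of_disjoint (by linarith) φ hd),
      integral_besselSymbol_mul_eq_of_disjoint hn φ hd hs⟩
  · exact ⟨integrable_besselTransform_mul hs φ.continuous
      (integrable_rpow_mul_schwartz_of_mem_strip hn φ hs (by linarith)),
      integral_besselSymbol_mul_eq_of_mem_strip hn φ hs (by linarith)⟩
  -- The Fourier-side pairing is the continuation, and its value at `ν` is `T φ` by definition.
  · exact ⟨fun s => ∫ ξ, besselSymbol n s ξ * invFourierCLM n φ ξ,
      differentiableOn_integral_besselSymbol_mul_invFourier hn φ, fun s h1 h2 =>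
      ⟨integrable_besselTransform_mul h1 φ.continuous
        (integrable_rpow_mul_schwartz_of_mem_strip hn φ h1 h2),
        integral_besselSymbol_mul_eq_of_mem_strip hn φ h1 h2⟩, rfl⟩
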